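/- Let $T$ be a complete first-order theory, possibly many-sorted, in a countable language (countably many sorts and symbols), and let $\mathfrak C\models T$ be a monster model: $\mathfrak C$ is $\kappa$-saturated and strongly $\kappa$-homogeneous for some cardinal $\kappa>2^{\aleph_0}$. Let $P$ be a product of countably many sorts of $\mathfrak C$ (with repetitions allowed). For $a,b\in P$ write $a\equiv b$ if $\operatorname{tp}(a/\emptyset)=\operatorname{tp}(b/\emptyset)$. For a set of parameters $A$, let $S_P(A)$ be the space of complete types over $A$ of elements of $P$, with the usual topology. For an $\operatorname{Aut}(\mathfrak C)$-invariant equivalence relation $R$ on $P$ we use the following terms. - $R$ is bounded if it has fewer than $\kappa$ classes. - $R$ is definable if $\{(a,b): a\mathrel R b\}$ is defined by a formula without parameters. It is type-definable if this set is defined by a set of formulas without parameters. It is $F_\sigma$ if $\{\operatorname{tp}(a,b/\emptyset): a\mathrel R b\}$ is an $F_\sigma$ subset of $S_{P^2}(\emptyset)$. - For a countable $M\preceq\mathfrak C$, let $R^M$ be the relation on $S_P(M)$ given by: $p\mathrel{R^M}q$ iff $a\mathrel R b$ for some $a\models p$, $b\models q$. A bounded $R$ is smooth if countable models $M\preceq\mathfrak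 C$ exist and for each of them there are a Polish space $Z$ and a Borel map $f:S_P(M)\to Z$ with $p\mathrel{R^M}q\iff f(p)=f(q)$ for all $p,q\in S_P(M)$. - $R$ is orbital on types if $R\subseteq{\equiv}$ and for every $p\in S_P(\emptyset)$ there is a group $\Gamma\le\operatorname{Aut}(\mathfrak C)$ that preserves setwise each class of the restriction of $R$ to the set $p(\mathfrak C)$ of realisations of $p$, and acts transitively on each of these classes. Let $E$ be a definable bounded equivalence relation on $P$, and let $p_0\in S_P(\emptyset)$ be a non-isolated complete type such that $p_0(\mathfrak C)$ is not contained in a single $E$-class. Then $E$ has only finitely many classes, and the relation $$E'(x,y)\iff\bigl(E(x,y)\lor x\not\models p_0\bigr)\land x\equiv y$$ is a bounded invariant equivalence relation on $P$ which is $F_\sigma$ and smooth, but not type-definable. Furthermore, if $E\cap{\equiv}$ is orbital on types, then so is $E'$. -/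

import Mathlib

open Cardinal Set

universe u v w x y

/-! ### Many-sorted first-order logic -/

/-- A many-sorted first-order language: sorts, function symbols with a list of argument sorts and a
value sort (constants have the empty list), and relation symbols with a list of argument sorts. -/
structure SortedLanguage where
  Sorts : Type u
  Func : List Sorts → Sorts → Type v
  Rel : List Sorts → Type v

namespace SortedLanguage

/-- The language is countable: countably many sorts, function symbols and relation symbols. -/
def IsCountable (L : SortedLanguage.{u, v}) : Prop :=
  Countable L.Sorts ∧ Countable (Σ (d : List L.Sorts) (s : L.Sorts), L.Func d s) ∧
    Countable (Σ d : List L.Sorts, L.Rel d)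

/-- `Bound l s` is the set of those variables among a list of variables whose sorts are listed by
`l` that have sort `s`; they serve as the bound variables (de Bruijn style). -/
inductive Bound {S : Type u} : List S → S → Type u
  | zero {s : S} {l : List S} : Bound (s :: l) s
  | succ {s t : S} {l : List S} (i : Bound l s) : Bound (t :: l) s

/-- A tuple of variables of `L` is a family `X`, where `X s` is the set of indices of the variables
of sort `s`. The concatenation of two tuples of variables: -/
abbrev Concat {S : Type u} (X : S → Type x) (Y : S → Type y) : S → Type (max x y) :=
  fun s => X s ⊕ Y s

/-- The tuple consisting of a single variable, of sort `s`. -/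
abbrev Single {S : Type u} (s : S) : S → Type := fun t => PLift (s = t)

/-- Terms with variables in `X`, by sort of the value. -/
inductive Term (L : SortedLanguage.{u, v}) (X : L.Sorts → Type x) : L.Sorts → Type (max u v x)
  | var {s : L.Sorts} (i : X s) : Term L X s
  | app {d : List L.Sorts} {s : L.Sorts} (f : L.Func d s)
      (ts : ∀ i : Fin d.length, Term L X (d.get i)) : Term L X s

/-- First-order formulas with free variables in `X` together with variables in `Bound l`. -/
inductive BoundedFormula (L : SortedLanguage.{u, v}) (X : L.Sorts → Type x) :
    List L.Sorts → Type (max u v x)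
  | falsum {l : List L.Sorts} : BoundedFormula L X l
  | equal {l : List L.Sorts} {s : L.Sorts} (t₁ t₂ : L.Term (Concat X (Bound l)) s) :
      BoundedFormula L X l
  | rel {l d : List L.Sorts} (R : L.Rel d)
      (ts : ∀ i : Fin d.length, L.Term (Concat X (Bound l)) (d.get i)) : BoundedFormula L X l
  | imp {l : List L.Sorts} (φ ψ : BoundedFormula L X l) : BoundedFormula L X l
  | all {l : List L.Sorts} (s : L.Sorts) (φ : BoundedFormula L X (s :: l)) : BoundedFormula L X l

/-- First-order formulas all of whose free variables are in `X`. -/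
abbrev Formula (L : SortedLanguage.{u, v}) (X : L.Sorts → Type x) : Type (max u v x) :=
  L.BoundedFormula X []

/-- Structures for a many-sorted language. -/
structure Str (L : SortedLanguage.{u, v}) where
  carrier : L.Sorts → Type w
  funMap {d : List L.Sorts} {s : L.Sorts} (f : L.Func d s)
    (a : ∀ i : Fin d.length, carrier (d.get i)) : carrier s
  relMap {d : List L.Sorts} (R : L.Rel d) (a : ∀ i : Fin d.length, carrier (d.get i)) : Prop

namespace Str

variable {L : SortedLanguage.{u, v}} (M : Str.{u, v, w} L)

/-- The product of sorts of `M` consisting of the tuples of values for the variables in `X`. -/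
abbrev Tuple (X : L.Sorts → Type x) : Type (max u w x) := ∀ s : L.Sorts, X s → M.carrier s

/-- The concatenation of two tuples. -/
def concat {X : L.Sorts → Type x} {Y : L.Sorts → Type y} (a : M.Tuple X) (b : M.Tuple Y) :
    M.Tuple (Concat X Y) :=
  fun s => Sum.elim (a s) (b s)

/-- Values of the bound variables: no value, and one more value at the front. -/
def boundNil : M.Tuple (Bound (S := L.Sorts) []) := fun _ i => nomatch i

def boundCons {l : List L.Sorts} {t : L.Sorts} (e : M.carrier t) (b : M.Tuple (Bound l)) :
    M.Tuple (Bound (t :: l))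
  | _, .zero => e
  | _, .succ i => b _ i

/-- The value of a term. -/
def eval {X : L.Sorts → Type x} (a : M.Tuple X) : {s : L.Sorts} → L.Term X s → M.carrier s
  | _, .var i => a _ i
  | _, .app f ts => M.funMap f fun i => eval a (ts i)

/-- Truth of a formula (with bound variables allowed to be free) in `M`. -/
def BRealize {X : L.Sorts → Type x} (a : M.Tuple X) :
    {l : List L.Sorts} → L.BoundedFormula X l → M.Tuple (Bound l) → Prop
  | _, .falsum, _ => False
  | _, .equal t₁ t₂, b => M.eval (M.concat a b) t₁ = M.eval (M.concat a b) t₂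
  | _, .rel R ts, b => M.relMap R fun i => M.eval (M.concat a b) (ts i)
  | _, .imp φ ψ, b => BRealize a φ b → BRealize a ψ b
  | _, .all s φ, b => ∀ e : M.carrier s, BRealize a φ (M.boundCons e b)

/-- `M ⊨ φ(a)`. -/
def Realize {X : L.Sorts → Type x} (φ : L.Formula X) (a : M.Tuple X) : Prop :=
  M.BRealize a φ M.boundNil

/-! ### Parameter sets, definable sets, types -/

/-- Sets of parameters in `M`: a set of elements of each sort. -/
abbrev Params : Type (max u w) := ∀ s : L.Sorts, Set (M.carrier s)

/-- The empty set of parameters. -/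
abbrev noParams : M.Params := fun _ => ∅

/-- A set of parameters, as a tuple of variables. -/
abbrev paramVars (A : M.Params) : L.Sorts → Type w := fun s => A s

/-- The tuple enumerating a set of parameters. -/
def paramTuple (A : M.Params) : M.Tuple (M.paramVars A) := fun _ e => e.1

/-- Formulas `φ(x, A)` with free variables in `X` and parameters from `A`. -/
abbrev FormulaOver (A : M.Params) (X : L.Sorts → Type x) : Type (max u v w x) :=
  L.Formula (Concat X (M.paramVars A))

variable {M}
variable {X : L.Sorts → Type x} {Y : L.Sorts → Type y}

/-- `M ⊨ φ(a, A)`. -/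
def RealizeOver {A : M.Params} (φ : M.FormulaOver A X) (a : M.Tuple X) : Prop :=
  M.Realize φ (M.concat a (M.paramTuple A))

/-- The complete type `tp(a/A)`, as a set of formulas. -/
def tp (A : M.Params) (a : M.Tuple X) : Set (M.FormulaOver A X) := {φ | RealizeOver φ a}

/-- `a ≡ b`: the tuples `a` and `b` have the same type over `∅`. -/
def SameType (a b : M.Tuple X) : Prop := tp M.noParams a = tp M.noParams b

/-- A set of tuples is definable over `A`. -/
def IsDefinable (A : M.Params) (D : Set (M.Tuple X)) : Prop :=
  ∃ φ : M.FormulaOver A X, D = {a | RealizeOver φ a}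

/-- A set of tuples is type-definable over `A`. -/
def IsTypeDefinable (A : M.Params) (D : Set (M.Tuple X)) : Prop :=
  ∃ Φ : Set (M.FormulaOver A X), D = {a | ∀ φ ∈ Φ, RealizeOver φ a}

variable (M X) in
/-- The space of complete types over `A` of elements of the product of sorts given by `X`. -/
def TypeSpace (A : M.Params) : Type (max u v w x) := range (tp A : M.Tuple X → _)

/-- The type of `a` over `A`, as a point of the type space. -/
def toType (A : M.Params) (a : M.Tuple X) : TypeSpace M X A := ⟨tp A a, a, rfl⟩

/-- The set of realisations in `M` of a type. -/
def TypeSpace.realisations {A : M.Params} (p : TypeSpace M X A) : Set (M.Tuple X) :=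
  {a | toType A a = p}

/-- The usual topology, with basis the sets `[φ] = {p | φ ∈ p}`. -/
instance (A : M.Params) : TopologicalSpace (TypeSpace M X A) :=
  TopologicalSpace.generateFrom (range fun φ : M.FormulaOver A X => {p | φ ∈ p.1})

/-- The complete type `p` is isolated. -/
def TypeSpace.IsIsolated {A : M.Params} (p : TypeSpace M X A) : Prop :=
  IsOpen ({p} : Set (TypeSpace M X A))

/-- The subset of the type space over `A` which corresponds to a set of tuples. -/
def typesOf (A : M.Params) (D : Set (M.Tuple X)) : Set (TypeSpace M X A) := toType A '' D

/-- The set of tuples `D` is `F_σ` over `A`: so is the corresponding set of types. -/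
def IsFSigma (A : M.Params) (D : Set (M.Tuple X)) : Prop :=
  ∃ F : ℕ → Set (TypeSpace M X A), (∀ n, IsClosed (F n)) ∧ typesOf A D = ⋃ n, F n

/-- A binary relation on tuples, as a set of concatenated pairs of tuples. -/
def relSet (R : M.Tuple X → M.Tuple X → Prop) : Set (M.Tuple (Concat X X)) :=
  {c | R (fun s i => c s (Sum.inl i)) (fun s i => c s (Sum.inr i))}

/-! ### Automorphisms and the monster model -/

variable (M) in
/-- The group of automorphisms of `M`. -/
def aut : Subgroup (∀ s : L.Sorts, Equiv.Perm (M.carrier s)) where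
  carrier := {g |
    (∀ (d : List L.Sorts) (s : L.Sorts) (f : L.Func d s)
      (a : ∀ i : Fin d.length, M.carrier (d.get i)),
      g s (M.funMap f a) = M.funMap f fun i => g (d.get i) (a i)) ∧
    ∀ (d : List L.Sorts) (R : L.Rel d) (a : ∀ i : Fin d.length, M.carrier (d.get i)),
      M.relMap R (fun i => g (d.get i) (a i)) ↔ M.relMap R a}
  mul_mem' := by
    rintro g h ⟨hg, hg'⟩ ⟨hh, hh'⟩
    refine ⟨fun d s f a => ?_, fun d R a => ?_⟩
    · simp only [Pi.mul_apply, Equiv.Perm.mul_apply, hh, hg]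
    · simp only [Pi.mul_apply, Equiv.Perm.mul_apply]
      rw [hg' d R fun i => h (d.get i) (a i), hh']
  one_mem' := by simp
  inv_mem' := by
    rintro g ⟨hg, hg'⟩
    refine ⟨fun d s f a => ?_, fun d R a => ?_⟩
    · simp only [Pi.inv_apply]
      rw [Equiv.Perm.inv_eq_iff_eq, hg]
      simp
    · rw [← hg']
      simp

/-- The action of (sort-preserving) permutations of `M` on tuples. -/
def act (g : ∀ s : L.Sorts, Equiv.Perm (M.carrier s)) (a : M.Tuple X) : M.Tuple X :=
  fun s i => g s (a s i)

variable (M) in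
/-- `M` is `κ`-saturated: every finitely satisfiable set of formulas in one variable over fewer than
`κ` parameters is realised in `M`. -/
def IsSaturated (κ : Cardinal.{max u w}) : Prop :=
  ∀ A : M.Params, #(Σ s, A s) < κ → ∀ (s : L.Sorts) (Φ : Set (M.FormulaOver A (Single s))),
    (∀ Ψ ⊆ Φ, Ψ.Finite → ∃ a : M.Tuple (Single s), ∀ φ ∈ Ψ, RealizeOver φ a) →
      ∃ a : M.Tuple (Single s), ∀ φ ∈ Φ, RealizeOver φ a

variable (M) in
/-- `M` is strongly `κ`-homogeneous: every elementary map whose domain is a subset of `M` with fewer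
than `κ` elements extends to an automorphism of `M`. -/
def IsStronglyHomogeneous (κ : Cardinal.{max u w}) : Prop :=
  ∀ A : M.Params, #(Σ s, A s) < κ → ∀ f : M.Tuple (M.paramVars A),
    (∀ φ : L.Formula (M.paramVars A), M.Realize φ (M.paramTuple A) ↔ M.Realize φ f) →
      ∃ g ∈ M.aut, act g (M.paramTuple A) = f

variable (M) in
/-- The structure induced on a family of subsets of the sorts which is closed under the functions
of `M`. -/
def induced (N : M.Params)
    (h : ∀ (d : List L.Sorts) (s : L.Sorts) (f : L.Func d s)
      (a : ∀ i : Fin d.length, M.carrier (d.get i)), (∀ i, a i ∈ N (d.get i)) →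
        M.funMap f a ∈ N s) : Str.{u, v, w} L where
  carrier s := N s
  funMap {d s} f a := ⟨M.funMap f fun i => (a i).1, h d s f _ fun i => (a i).2⟩
  relMap R a := M.relMap R fun i => (a i).1

variable (M) in
/-- `N` is (the universe of) an elementary substructure of `M`: it is closed under the functions of
`M`, and formulas with parameters from `N` have the same truth value in `N` and in `M`. -/
def IsElementarySub (N : M.Params) : Prop :=
  ∃ h, ∀ φ : L.Formula (M.paramVars N),
    (M.induced N h).Realize φ (fun _ e => e) ↔ M.Realize φ (M.paramTuple N)

/-! ### Equivalence relations on products of sorts -/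

/-- A relation on tuples is invariant under all automorphisms of `M`. -/
def IsInvariantRel (R : M.Tuple X → M.Tuple X → Prop) : Prop :=
  ∀ g ∈ M.aut, ∀ a b : M.Tuple X, R (act g a) (act g b) ↔ R a b

/-- The set of classes of an equivalence relation. -/
def classes {α : Type y} (R : α → α → Prop) : Set (Set α) := range fun a => {b | R a b}

/-- The restriction of the equivalence relation `R` to a set `D` is orbital: some group of
automorphisms preserves each class setwise and acts transitively on each class. -/
def IsOrbitalOn (R : M.Tuple X → M.Tuple X → Prop) (D : Set (M.Tuple X)) : Prop :=
  ∃ Γ : Subgroup (∀ s : L.Sorts, Equiv.Perm (M.carrier s)), Γ ≤ M.aut ∧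
    (∀ g ∈ Γ, ∀ a ∈ D, act g '' {b ∈ D | R a b} = {b ∈ D | R a b}) ∧
    ∀ a ∈ D, ∀ b ∈ D, R a b → ∃ g ∈ Γ, act g a = b

/-- The equivalence relation `R` is orbital on types: it refines type, and its restriction to (the
set of realisations of) any complete type over `∅` is orbital. -/
def IsOrbitalOnTypes (R : M.Tuple X → M.Tuple X → Prop) : Prop :=
  (∀ a b, R a b → SameType a b) ∧
    ∀ p : TypeSpace M X M.noParams, IsOrbitalOn R p.realisations

/-- The relation on types over `N` induced by a relation on tuples. -/
def onTypes (N : M.Params) (R : M.Tuple X → M.Tuple X → Prop) (p q : TypeSpace M X N) : Prop :=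
  ∃ a ∈ p.realisations, ∃ b ∈ q.realisations, R a b

end Str

end SortedLanguage

/-- Borel reducibility of relations on topological spaces. -/
def BorelReducible {α : Type x} {β : Type y} [TopologicalSpace α] [TopologicalSpace β]
    (E : α → α → Prop) (F : β → β → Prop) : Prop :=
  ∃ f : α → β, @Measurable α β (borel α) (borel β) f ∧ ∀ p q, E p q ↔ F (f p) (f q)

/-- A relation is smooth: it is Borel reducible to equality on some Polish space. -/
def IsSmoothRel {α : Type x} [TopologicalSpace α] (E : α → α → Prop) : Prop :=
  ∃ (Z : Type) (_ : TopologicalSpace Z), PolishSpace Z ∧ BorelReducible E (Eq : Z → Z → Prop)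

namespace SortedLanguage.Str

variable {L : SortedLanguage.{u, v}} {M : Str.{u, v, w} L} {X : L.Sorts → Type x}

/-- The relation `R` on tuples is smooth: the relation which it induces on types over a countable
elementary submodel `N` of `M` is smooth. This is required of all countable `N` (of which there has
to be one). -/
def IsSmooth (R : M.Tuple X → M.Tuple X → Prop) : Prop :=
  (∃ N : M.Params, M.IsElementarySub N ∧ Countable (Σ s, N s)) ∧
    ∀ N : M.Params, M.IsElementarySub N → Countable (Σ s, N s) → IsSmoothRel (onTypes N R)

/-- The relation `(E(x, y) ∨ ¬ p₀(x)) ∧ x ≡ y`. -/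
def cutRel (E : M.Tuple X → M.Tuple X → Prop) (p₀ : TypeSpace M X M.noParams)
    (a b : M.Tuple X) : Prop :=
  (E a b ∨ a ∉ p₀.realisations) ∧ SameType a b

end SortedLanguage.Str

open SortedLanguage.Str

/-! Write `E'` for `cutRel E p₀`. It agrees with `E ∩ ≡` on `p₀` and with `≡` on every other type.

Finiteness is compactness: with infinitely many classes, the conditions `¬ E(r_C, x)`, one for each
class `C` with representative `r_C`, would be finitely satisfiable over fewer than `κ` parameters,
and a solution would lie in no class (`IsSaturated.finite_classes`). An `E'`-class is determined by
a type over `∅` and an `E`-class, which bounds their number. The condition `x ⊭ p₀` is a countable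
union of closed conditions `¬ χ(x)` with `χ ∈ p₀`, so `E'` is `F_σ`. By finiteness every `E`-class
meets every elementary submodel `N` (`IsElementarySub.exists_mem_rel`), hence is definable over `N`.
Thus the type over `∅` together with, on `p₀`, the `E`-class gives countably many bits read off from
`tp(a/N)`, which classify `E'`.

For the failure of type-definability, choose realisations `a₀`, `b₀` of `p₀` in different
`E`-classes and an automorphism `g` taking `a₀` to `b₀`. As `p₀` is not isolated and `E` has
finitely many classes, every formula of `p₀` holds at some `b` in the `E`-class of `a₀` that does
not realise `p₀` (`exists_realize_rel_not_sameType`). Then `E'(b, g b)` but not `E(b, g b)`. If `E'`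
were type-definable, a limit of such pairs would be a pair that is `E'`-related and not `E`-related,
with first entry realising `p₀`, which is absurd.

The hypotheses speak of one variable at a time, while the tuples here may be infinite.
`IsSaturated.exists_forall_realizeOver`, `IsStronglyHomogeneous.exists_act_eq` and
`IsElementarySub.exists_mem` carry saturation, homogeneity and elementarity over to tuples. -/

namespace SortedLanguage

variable {L : SortedLanguage.{u, v}} {X : L.Sorts → Type x} {Y : L.Sorts → Type y}

/-! ### Renaming variables -/

/-- Renaming the variables of a term. -/
def Term.rename (σ : ∀ s, X s → Y s) : {s : L.Sorts} → L.Term X s → L.Term Y s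
  | _, .var i => .var (σ _ i)
  | _, .app f ts => .app f fun i => (ts i).rename σ

/-- Extension of a renaming of variables under a quantifier. -/
def liftRenaming {l l' : List L.Sorts} (t : L.Sorts)
    (σ : ∀ s, Concat X (Bound l) s → Concat Y (Bound l') s) :
    ∀ s, Concat X (Bound (t :: l)) s → Concat Y (Bound (t :: l')) s
  | _, .inl i => Sum.map id .succ (σ _ (.inl i))
  | _, .inr .zero => .inr .zero
  | _, .inr (.succ i) => Sum.map id .succ (σ _ (.inr i))

/-- Renaming the variables of a formula, where free variables may become bound ones and
vice versa. -/
def BoundedFormula.rename : {l l' : List L.Sorts} →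
    (∀ s, Concat X (Bound l) s → Concat Y (Bound l') s) →
      L.BoundedFormula X l → L.BoundedFormula Y l'
  | _, _, _, .falsum => .falsum
  | _, _, σ, .equal t₁ t₂ => .equal (t₁.rename σ) (t₂.rename σ)
  | _, _, σ, .rel R ts => .rel R fun i => (ts i).rename σ
  | _, _, σ, .imp φ ψ => .imp (φ.rename σ) (ψ.rename σ)
  | _, _, σ, .all s φ => .all s (φ.rename (liftRenaming s σ))

/-- Renaming the free variables of a formula. -/
def Formula.map (σ : ∀ s, X s → Y s) (φ : L.Formula X) : L.Formula Y :=
  φ.rename fun s => Sum.map (σ s) id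

/-- The negation of a formula. -/
def Formula.not (φ : L.Formula X) : L.Formula X := φ.imp .falsum

/-- The conjunction of two formulas. -/
def Formula.and (φ ψ : L.Formula X) : L.Formula X := Formula.not (φ.imp ψ.not)

/-- The biconditional of two formulas. -/
def Formula.iff (φ ψ : L.Formula X) : L.Formula X := Formula.and (φ.imp ψ) (ψ.imp φ)

open Classical in
/-- Existential quantification over a free variable, which remains a (dummy) free variable. -/
noncomputable def Formula.exVar (k : Σ s, X s) (φ : L.Formula X) : L.Formula X :=
  Formula.not <| .all k.1 <| φ.not.rename fun s => Sum.elim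
    (fun i => Function.update (β := fun j : Σ s, X s => Concat X (Bound [k.1]) j.1)
      (fun j => Sum.inl j.2) k (.inr .zero) ⟨s, i⟩) fun i : Bound [] s => nomatch i

/-- Existential quantification over the variables in a single-variable tuple. -/
def Formula.exSingle {s : L.Sorts} (φ : L.Formula (Concat (Single s) Y)) : L.Formula Y :=
  Formula.not <| .all s <| φ.not.rename fun t => Sum.elim
    (Sum.elim (fun i : Single s t => .inr (i.down ▸ .zero)) Sum.inl)
    fun i : Bound [] t => nomatch i

namespace Str

variable {M : Str.{u, v, w} L}

open Classical in
/-- The tuple `a` with the value at the variable `k` replaced by `e`. -/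
noncomputable def updateAt (a : M.Tuple X) (k : Σ s, X s) (e : M.carrier k.1) : M.Tuple X :=
  fun s i => Function.update (β := fun j : Σ s, X s => M.carrier j.1)
    (fun j => a j.1 j.2) k e ⟨s, i⟩

theorem updateAt_of_ne (a : M.Tuple X) {k j : Σ s, X s} (h : j ≠ k) (e : M.carrier k.1) :
    updateAt a k e j.1 j.2 = a j.1 j.2 := by
  classical
  exact Function.update_of_ne (β := fun j : Σ s, X s => M.carrier j.1) h e fun j => a j.1 j.2

theorem updateAt_self (a : M.Tuple X) (k : Σ s, X s) (e : M.carrier k.1) :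
    updateAt a k e k.1 k.2 = e := by
  classical
  exact Function.update_self (β := fun j : Σ s, X s => M.carrier j.1) k e fun j => a j.1 j.2

theorem eval_rename (σ : ∀ s, X s → Y s) (a : M.Tuple Y) {s : L.Sorts} (t : L.Term X s) :
    M.eval a (t.rename σ) = M.eval (fun s i => a s (σ s i)) t := by
  induction t with
  | var i => rfl
  | app f ts ih => simp only [Term.rename, eval, ih]

theorem concat_liftRenaming {l l' : List L.Sorts} {t : L.Sorts}
    {σ : ∀ s, Concat X (Bound l) s → Concat Y (Bound l') s} {a : M.Tuple Y} {a' : M.Tuple X}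
    {b : M.Tuple (Bound l')} {b' : M.Tuple (Bound l)}
    (h : ∀ s i, M.concat a b s (σ s i) = M.concat a' b' s i) (e : M.carrier t) (s : L.Sorts)
    (i : Concat X (Bound (t :: l)) s) :
    M.concat a (M.boundCons e b) s (liftRenaming t σ s i)
      = M.concat a' (M.boundCons e b') s i := by
  have key (j : Concat Y (Bound l') s) :
      M.concat a (M.boundCons e b) s (Sum.map id .succ j) = M.concat a b s j := by
    cases j <;> rfl
  match s, i with
  | _, .inl i => exact (key _).trans (h _ _)
  | _, .inr .zero => rfl
  | _, .inr (.succ i) => exact (key _).trans (h _ _)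

/-- Since free and bound variables may be exchanged, compatibility is assumed for the two combined
assignments. This form passes under quantifiers, and serves existential quantification as well as
the Tarski–Vaught test. -/
theorem bRealize_rename {l l' : List L.Sorts}
    (σ : ∀ s, Concat X (Bound l) s → Concat Y (Bound l') s) (φ : L.BoundedFormula X l)
    {a : M.Tuple Y} {a' : M.Tuple X} {b : M.Tuple (Bound l')} {b' : M.Tuple (Bound l)}
    (h : ∀ s i, M.concat a b s (σ s i) = M.concat a' b' s i) :
    M.BRealize a (φ.rename σ) b ↔ M.BRealize a' φ b' := by
  induction φ generalizing l' with
  | falsum => rfl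
  | equal t₁ t₂ =>
    simp only [BoundedFormula.rename, BRealize, eval_rename, h]
  | rel R ts =>
    simp only [BoundedFormula.rename, BRealize, eval_rename, h]
  | imp φ ψ ih₁ ih₂ => exact imp_congr (ih₁ σ h) (ih₂ σ h)
  | all s φ ih => exact forall_congr' fun e => ih _ (concat_liftRenaming h e)

@[simp]
theorem realize_map (σ : ∀ s, X s → Y s) (φ : L.Formula X) (a : M.Tuple Y) :
    M.Realize (φ.map σ) a ↔ M.Realize φ (fun s i => a s (σ s i)) :=
  bRealize_rename _ φ (by rintro s (i | i); exacts [rfl, nomatch i])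

@[simp]
theorem realize_not (φ : L.Formula X) (a : M.Tuple X) :
    M.Realize φ.not a ↔ ¬ M.Realize φ a := Iff.rfl

@[simp]
theorem realize_imp (φ ψ : L.Formula X) (a : M.Tuple X) :
    M.Realize (.imp φ ψ) a ↔ (M.Realize φ a → M.Realize ψ a) := Iff.rfl

@[simp]
theorem realize_and (φ ψ : L.Formula X) (a : M.Tuple X) :
    M.Realize (φ.and ψ) a ↔ M.Realize φ a ∧ M.Realize ψ a := by
  simp [Formula.and]

@[simp]
theorem realize_iff (φ ψ : L.Formula X) (a : M.Tuple X) :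
    M.Realize (φ.iff ψ) a ↔ (M.Realize φ a ↔ M.Realize ψ a) := by
  simp [Formula.iff, iff_iff_implies_and_implies]

@[simp]
theorem realize_exVar (k : Σ s, X s) (φ : L.Formula X) (a : M.Tuple X) :
    M.Realize (φ.exVar k) a ↔ ∃ e, M.Realize φ (updateAt a k e) := by
  classical
  rw [← not_forall_not]
  refine not_congr (forall_congr' fun e => ?_)
  refine (bRealize_rename _ φ.not (a' := updateAt a k e) (b' := M.boundNil) ?_)
  rintro s (i | i)
  · by_cases h : (⟨s, i⟩ : Σ s, X s) = k
    · subst h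
      simp [concat, boundCons, updateAt]
    · simp [concat, updateAt, Function.update_of_ne h]
  · nomatch i

/-- A tuple of length one. -/
def single {s : L.Sorts} (e : M.carrier s) : M.Tuple (Single s) := fun _ i => i.down ▸ e

theorem eq_single {s : L.Sorts} (a : M.Tuple (Single s)) : a = single (a s ⟨rfl⟩) := by
  funext t i
  obtain ⟨rfl⟩ := i
  rfl

@[simp]
theorem realize_exSingle {s : L.Sorts} (φ : L.Formula (Concat (Single s) Y)) (a : M.Tuple Y) :
    M.Realize φ.exSingle a ↔ ∃ e, M.Realize φ (M.concat (single e) a) := by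
  rw [← not_forall_not]
  refine not_congr (forall_congr' fun e => ?_)
  refine (bRealize_rename _ φ.not (a' := M.concat (single e) a) (b' := M.boundNil) ?_)
  rintro t ((i | i) | i)
  · obtain ⟨rfl⟩ := i; rfl
  · rfl
  · nomatch i

theorem exists_realize_iff_forall_mem {Ψ : Set (L.Formula X)} (hΨ : Ψ.Finite) :
    ∃ φ : L.Formula X, ∀ a : M.Tuple X, M.Realize φ a ↔ ∀ ψ ∈ Ψ, M.Realize ψ a := by
  induction Ψ, hΨ using Set.Finite.induction_on with
  | empty => exact ⟨.imp .falsum .falsum, fun a => by simp⟩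
  | @insert ψ _ _ _ ih =>
    obtain ⟨φ, hφ⟩ := ih
    exact ⟨Formula.and ψ φ, fun a => by rw [realize_and, hφ, forall_mem_insert]⟩

/-! ### Finite supports -/

theorem exists_finset_eval_congr {s : L.Sorts} (t : L.Term X s) :
    ∃ F : Finset (Σ s, X s), ∀ a a' : M.Tuple X, (∀ k ∈ F, a k.1 k.2 = a' k.1 k.2) →
      M.eval a t = M.eval a' t := by
  classical
  induction t with
  | var i => exact ⟨{⟨_, i⟩}, fun a a' h => h ⟨_, i⟩ (by simp)⟩
  | app f ts ih =>
    choose F hF using ih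
    refine ⟨Finset.univ.biUnion F, fun a a' h => congrArg (M.funMap f) <| funext fun i =>
      hF i a a' fun k hk => h k ?_⟩
    exact Finset.mem_biUnion.2 ⟨i, Finset.mem_univ _, hk⟩

theorem exists_finset_eval_concat_congr {l : List L.Sorts} {s : L.Sorts}
    (t : L.Term (Concat X (Bound l)) s) :
    ∃ F : Finset (Σ s, X s), ∀ a a' : M.Tuple X, (∀ k ∈ F, a k.1 k.2 = a' k.1 k.2) →
      ∀ b : M.Tuple (Bound l), M.eval (M.concat a b) t = M.eval (M.concat a' b) t := by
  classical
  obtain ⟨F, hF⟩ := exists_finset_eval_congr (M := M) t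
  refine ⟨F.biUnion fun k => Sum.elim (fun i => {⟨k.1, i⟩}) (fun _ => ∅) k.2,
    fun a a' h b => hF _ _ ?_⟩
  rintro ⟨s, i | i⟩ hk
  · exact h ⟨s, i⟩ (Finset.mem_biUnion.2 ⟨_, hk, by simp⟩)
  · rfl

theorem exists_finset_bRealize_congr {l : List L.Sorts} (φ : L.BoundedFormula X l) :
    ∃ F : Finset (Σ s, X s), ∀ a a' : M.Tuple X, (∀ k ∈ F, a k.1 k.2 = a' k.1 k.2) →
      ∀ b : M.Tuple (Bound l), M.BRealize a φ b ↔ M.BRealize a' φ b := by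
  classical
  induction φ with
  | falsum => exact ⟨∅, fun _ _ _ _ => Iff.rfl⟩
  | equal t₁ t₂ =>
    obtain ⟨F₁, h₁⟩ := exists_finset_eval_concat_congr (M := M) t₁
    obtain ⟨F₂, h₂⟩ := exists_finset_eval_concat_congr (M := M) t₂
    refine ⟨F₁ ∪ F₂, fun a a' h b => ?_⟩
    rw [BRealize, BRealize, h₁ a a' (fun k hk => h k (Finset.mem_union_left _ hk)),
      h₂ a a' (fun k hk => h k (Finset.mem_union_right _ hk))]
  | rel R ts =>
    choose F hF using fun i => exists_finset_eval_concat_congr (M := M) (ts i)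
    refine ⟨Finset.univ.biUnion F, fun a a' h b => ?_⟩
    rw [BRealize, BRealize, funext fun i => hF i a a' (fun k hk => h k
      (Finset.mem_biUnion.2 ⟨i, Finset.mem_univ _, hk⟩)) b]
  | imp φ ψ ih₁ ih₂ =>
    obtain ⟨F₁, h₁⟩ := ih₁
    obtain ⟨F₂, h₂⟩ := ih₂
    exact ⟨F₁ ∪ F₂, fun a a' h b => imp_congr
      (h₁ a a' (fun k hk => h k (Finset.mem_union_left _ hk)) b)
      (h₂ a a' (fun k hk => h k (Finset.mem_union_right _ hk)) b)⟩
  | all s φ ih =>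
    obtain ⟨F, hF⟩ := ih
    exact ⟨F, fun a a' h b => forall_congr' fun e => hF a a' h _⟩

/-- Finite support is what lets infinite tuples be built or replaced one coordinate at a time, and
puts the relevant parameters of a formula into one stage of a countable chain. -/
theorem exists_finset_realize_congr (φ : L.Formula X) :
    ∃ F : Finset (Σ s, X s), ∀ a a' : M.Tuple X, (∀ k ∈ F, a k.1 k.2 = a' k.1 k.2) →
      (M.Realize φ a ↔ M.Realize φ a') :=
  (exists_finset_bRealize_congr φ).imp fun _ h a a' ha => h a a' ha _

/-! ### Automorphisms preserve truth -/

theorem eval_act {g : ∀ s : L.Sorts, Equiv.Perm (M.carrier s)} (hg : g ∈ M.aut) (a : M.Tuple X)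
    {s : L.Sorts} (t : L.Term X s) : M.eval (act g a) t = g s (M.eval a t) := by
  induction t with
  | var i => rfl
  | app f ts ih => simp only [eval, ih, hg.1]

theorem act_concat (g : ∀ s : L.Sorts, Equiv.Perm (M.carrier s)) (a : M.Tuple X)
    (b : M.Tuple Y) : act g (M.concat a b) = M.concat (act g a) (act g b) := by
  funext s i
  cases i <;> rfl

theorem bRealize_act {g : ∀ s : L.Sorts, Equiv.Perm (M.carrier s)} (hg : g ∈ M.aut)
    (a : M.Tuple X) {l : List L.Sorts} (φ : L.BoundedFormula X l) (b : M.Tuple (Bound l)) :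
    M.BRealize (act g a) φ (act g b) ↔ M.BRealize a φ b := by
  induction φ with
  | falsum => rfl
  | equal t₁ t₂ =>
    simp only [BRealize, ← act_concat, eval_act hg, EmbeddingLike.apply_eq_iff_eq]
  | rel R ts => simp only [BRealize, ← act_concat, eval_act hg, hg.2]
  | imp φ ψ ih₁ ih₂ => exact imp_congr (ih₁ b) (ih₂ b)
  | all s φ ih =>
    -- The map `g s` is onto, so the quantifier may range over the values `g s e`.
    refine (g s).forall_congr_right.symm.trans (forall_congr' fun e => ?_)
    rw [← ih]
    refine iff_of_eq (congrArg _ ?_)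
    funext t i
    cases i <;> rfl

theorem realize_act {g : ∀ s : L.Sorts, Equiv.Perm (M.carrier s)} (hg : g ∈ M.aut)
    (φ : L.Formula X) (a : M.Tuple X) : M.Realize φ (act g a) ↔ M.Realize φ a := by
  rw [Realize, Realize, ← bRealize_act hg a]
  refine iff_of_eq (congrArg _ ?_)
  funext t i
  nomatch i

end Str

/-! ### Counting formulas -/

instance (l : List L.Sorts) : Countable (Σ s, Bound l s) := by
  induction l with
  | nil =>
    have : IsEmpty (Σ s : L.Sorts, Bound [] s) := ⟨fun ⟨_, i⟩ => nomatch i⟩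
    infer_instance
  | cons t l ih =>
    refine Function.Surjective.countable (α := Option (Σ s, Bound l s))
      (f := fun o => o.elim ⟨t, .zero⟩ fun k => ⟨k.1, .succ k.2⟩) ?_
    rintro ⟨s, _ | i⟩
    · exact ⟨none, rfl⟩
    · exact ⟨some ⟨s, i⟩, rfl⟩

theorem countable_concat (hX : Countable (Σ s, X s)) (hY : Countable (Σ s, Y s)) :
    Countable (Σ s, Concat X Y s) :=
  Function.Surjective.countable (α := (Σ s, X s) ⊕ (Σ s, Y s))
    (f := Sum.elim (fun k => ⟨k.1, .inl k.2⟩) fun k => ⟨k.1, .inr k.2⟩) (by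
      rintro ⟨s, i | i⟩
      exacts [⟨.inl ⟨s, i⟩, rfl⟩, ⟨.inr ⟨s, i⟩, rfl⟩])

/-- The terms of a bounded depth. -/
def termsOfDepth (X : L.Sorts → Type x) : ℕ → ∀ s, Set (L.Term X s)
  | 0, _ => ∅
  | n + 1, s => termsOfDepth X n s ∪ (range .var ∪ ⋃ (d) (f : L.Func d s),
      Term.app f '' univ.pi fun i => termsOfDepth X n (d.get i))

theorem termsOfDepth_mono (s : L.Sorts) : Monotone fun n => termsOfDepth X n s :=
  monotone_nat_of_le_succ fun _ => subset_union_left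

theorem exists_mem_termsOfDepth {s : L.Sorts} (t : L.Term X s) :
    ∃ n, t ∈ termsOfDepth X n s := by
  induction t with
  | var i => exact ⟨1, .inr <| .inl ⟨i, rfl⟩⟩
  | app f ts ih =>
    choose n hn using ih
    refine ⟨Finset.univ.sup n + 1, .inr <| .inr <| mem_iUnion₂.2 ⟨_, f, ts, fun i _ => ?_, rfl⟩⟩
    exact termsOfDepth_mono _ (Finset.le_sup (Finset.mem_univ i)) (hn i)

/-- Each depth adds countably many symbols applied to finite tuples from countable sets; the
induction treats all sorts at once. -/
theorem Term.countable (hL : L.IsCountable) (hX : Countable (Σ s, X s)) (s : L.Sorts) :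
    Countable (L.Term X s) := by
  have := hL.1
  have hF (d s) : Countable (L.Func d s) :=
    have := hL.2.1
    Function.Injective.countable (β := Σ (d : List L.Sorts) (s : L.Sorts), L.Func d s)
      (f := fun f => ⟨d, s, f⟩) fun f g h => by simpa using h
  have hv (s) : Countable (X s) := (sigma_mk_injective (i := s)).countable
  have key (n : ℕ) : ∀ s, (termsOfDepth X n s).Countable := by
    induction n with
    | zero => exact fun s => countable_empty
    | succ n ih =>
      refine fun s => (ih s).union <| (countable_range _).union <| countable_iUnion fun d =>
        countable_iUnion fun f => Countable.image ?_ _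
      exact countable_univ_pi fun i => ih _
  refine countable_univ_iff.1 ((countable_iUnion fun n => key n s).mono fun t _ => ?_)
  exact mem_iUnion.2 (exists_mem_termsOfDepth t)

/-- The formulas of a bounded depth. -/
def formulasOfDepth (X : L.Sorts → Type x) : ℕ → ∀ l, Set (L.BoundedFormula X l)
  | 0, _ => ∅
  | n + 1, l => formulasOfDepth X n l ∪ ({.falsum} ∪
      ((⋃ s, range fun t : L.Term (Concat X (Bound l)) s × L.Term (Concat X (Bound l)) s =>
        .equal t.1 t.2) ∪
      ((⋃ (d) (R : L.Rel d), range (.rel R)) ∪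
      (image2 .imp (formulasOfDepth X n l) (formulasOfDepth X n l) ∪
      ⋃ s, .all s '' formulasOfDepth X n (s :: l)))))

theorem formulasOfDepth_mono (l : List L.Sorts) : Monotone fun n => formulasOfDepth X n l :=
  monotone_nat_of_le_succ fun _ => subset_union_left

theorem exists_mem_formulasOfDepth {l : List L.Sorts} (φ : L.BoundedFormula X l) :
    ∃ n, φ ∈ formulasOfDepth X n l := by
  induction φ with
  | falsum => exact ⟨1, .inr <| .inl rfl⟩
  | equal t₁ t₂ => exact ⟨1, .inr <| .inr <| .inl <| mem_iUnion.2 ⟨_, (t₁, t₂), rfl⟩⟩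
  | rel R ts => exact ⟨1, .inr <| .inr <| .inr <| .inl <| mem_iUnion₂.2 ⟨_, R, ts, rfl⟩⟩
  | imp φ ψ ih₁ ih₂ =>
    obtain ⟨m, hm⟩ := ih₁
    obtain ⟨n, hn⟩ := ih₂
    exact ⟨max m n + 1, .inr <| .inr <| .inr <| .inr <| .inl
      ⟨φ, formulasOfDepth_mono _ (le_max_left m n) hm, ψ,
        formulasOfDepth_mono _ (le_max_right m n) hn, rfl⟩⟩
  | all s φ ih =>
    obtain ⟨n, hn⟩ := ih
    exact ⟨n + 1, .inr <| .inr <| .inr <| .inr <| .inr <| mem_iUnion.2 ⟨s, φ, hn, rfl⟩⟩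

theorem BoundedFormula.countable (hL : L.IsCountable) (hX : Countable (Σ s, X s))
    (l : List L.Sorts) : Countable (L.BoundedFormula X l) := by
  have := hL.1
  have hR (d) : Countable (L.Rel d) :=
    have := hL.2.2
    (sigma_mk_injective (β := L.Rel) (i := d)).countable
  have hT (l : List L.Sorts) (s) : Countable (L.Term (Concat X (Bound l)) s) :=
    Term.countable hL (countable_concat hX inferInstance) s
  have key (n : ℕ) : ∀ l, (formulasOfDepth X n l).Countable := by
    induction n with
    | zero => exact fun s => countable_empty
    | succ n ih =>
      exact fun l => (ih l).union <| (countable_singleton _).union <|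
        (countable_iUnion fun s => countable_range _).union <|
        (countable_iUnion fun d => countable_iUnion fun R => countable_range _).union <|
        ((ih l).image2 (ih l) _).union <| countable_iUnion fun s => (ih _).image _
  refine countable_univ_iff.1 ((countable_iUnion fun n => key n l).mono fun t _ => ?_)
  exact mem_iUnion.2 (exists_mem_formulasOfDepth t)

end SortedLanguage

namespace SortedLanguage.Str

variable {L : SortedLanguage.{u, v}} {M : Str.{u, v, w} L}
variable {X : L.Sorts → Type x} {Y : L.Sorts → Type y}

/-! ### Formulas with parameters -/

theorem concat_updateAt (a : M.Tuple X) (b : M.Tuple Y) (k : Σ s, X s) (e : M.carrier k.1) :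
    M.concat (updateAt a k e) b = updateAt (X := Concat X Y) (M.concat a b) ⟨k.1, .inl k.2⟩ e := by
  classical
  obtain ⟨t, j⟩ := k
  funext s i
  rcases i with i | i
  · by_cases h : (⟨s, i⟩ : Σ s, X s) = ⟨t, j⟩
    · cases h
      exact (updateAt_self a ⟨t, j⟩ e).trans
        (updateAt_self (X := Concat X Y) (M.concat a b) ⟨t, .inl j⟩ e).symm
    · refine (updateAt_of_ne a (j := ⟨s, i⟩) h e).trans (updateAt_of_ne (X := Concat X Y)
        (M.concat a b) (k := ⟨t, .inl j⟩) (j := ⟨s, .inl i⟩) ?_ e).symm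
      intro h'
      cases h'
      exact h rfl
  · refine (updateAt_of_ne (X := Concat X Y)
      (M.concat a b) (k := ⟨t, .inl j⟩) (j := ⟨s, .inr i⟩) ?_ e).symm
    intro h
    cases h

theorem exists_realizeOver_iff_exists {A : M.Params} (φ : M.FormulaOver A X) (k : Σ s, X s) :
    ∃ ψ : M.FormulaOver A X, ∀ a : M.Tuple X,
      RealizeOver ψ a ↔ ∃ e, RealizeOver φ (updateAt a k e) :=
  ⟨Formula.exVar ⟨k.1, .inl k.2⟩ φ, fun a => by
    simp only [RealizeOver, realize_exVar, concat_updateAt]⟩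

/-- The entries of `c` away from `k` become parameters and `k` becomes the only free variable, which
brings one-variable saturation and elementarity to bear. -/
theorem exists_realizeOver_single_iff {A B : M.Params} (hAB : ∀ s, A s ⊆ B s) {c : M.Tuple X}
    (hc : ∀ s i, c s i ∈ B s) (φ : M.FormulaOver A X) (k : Σ s, X s) :
    ∃ ψ : M.FormulaOver B (Single k.1), ∀ e,
      RealizeOver ψ (single e) ↔ RealizeOver φ (updateAt c k e) := by
  classical
  refine ⟨φ.map fun s => Sum.elim (fun i =>
    Function.update (β := fun j : Σ s, X s => Concat (Single k.1) (M.paramVars B) j.1)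
      (fun j => .inr ⟨c j.1 j.2, hc _ _⟩) k (.inl ⟨rfl⟩) ⟨s, i⟩)
      fun e => .inr ⟨e.1, hAB s e.2⟩, fun e => ?_⟩
  rw [RealizeOver, realize_map, RealizeOver]
  refine iff_of_eq (congrArg _ ?_)
  funext s i
  rcases i with i | i
  · by_cases h : (⟨s, i⟩ : Σ s, X s) = k
    · subst h
      simp [concat, updateAt, single]
    · simp [concat, updateAt, Function.update_of_ne h, paramTuple]
  · rfl

theorem exists_realizeOver_iff_forall_mem {A : M.Params} {Ψ : Set (M.FormulaOver A X)}
    (hΨ : Ψ.Finite) :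
    ∃ φ : M.FormulaOver A X, ∀ a : M.Tuple X, RealizeOver φ a ↔ ∀ ψ ∈ Ψ, RealizeOver ψ a :=
  (exists_realize_iff_forall_mem hΨ).imp fun _ h _ => h _

/-- Whether `a` satisfies `φ` depends only on the values of `a` at the variables in `S`. -/
def SupportedOn {A : M.Params} (S : Set (Σ s, X s)) (φ : M.FormulaOver A X) : Prop :=
  ∀ a a' : M.Tuple X, (∀ k ∈ S, a k.1 k.2 = a' k.1 k.2) → (RealizeOver φ a ↔ RealizeOver φ a')

theorem exists_finset_supportedOn {A : M.Params} (φ : M.FormulaOver A X) :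
    ∃ F : Finset (Σ s, X s), SupportedOn F φ := by
  classical
  obtain ⟨F, hF⟩ := exists_finset_realize_congr (M := M) φ
  refine ⟨F.biUnion fun k => Sum.elim (fun i => {⟨k.1, i⟩}) (fun _ => ∅) k.2,
    fun a a' h => hF _ _ ?_⟩
  rintro ⟨s, i | i⟩ hk
  · exact h ⟨s, i⟩ (Finset.mem_biUnion.2 ⟨_, hk, by simp⟩)
  · rfl

theorem SupportedOn.of_realizeOver_iff_exists {A : M.Params} {S T : Set (Σ s, X s)}
    {φ ψ : M.FormulaOver A X} {k : Σ s, X s} (hφ : SupportedOn T φ)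
    (hψ : ∀ a : M.Tuple X, RealizeOver ψ a ↔ ∃ e, RealizeOver φ (updateAt a k e))
    (hST : ∀ j ∈ T, j ≠ k → j ∈ S) : SupportedOn S ψ := by
  intro a a' h
  rw [hψ, hψ]
  refine exists_congr fun e => hφ _ _ fun j hj => ?_
  by_cases hjk : j = k
  · subst hjk
    rw [updateAt_self, updateAt_self]
  · rw [updateAt_of_ne _ hjk, updateAt_of_ne _ hjk, h j (hST j hj hjk)]

/-! ### Saturation for tuples of variables -/

theorem mk_sigma_range_le_aleph0 (hX : Countable (Σ s, X s)) (c : M.Tuple X) :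
    #(Σ s, range (c s)) ≤ ℵ₀ := by
  rw [Cardinal.mk_le_aleph0_iff]
  exact Function.Surjective.countable (α := Σ s, X s)
    (f := fun k => ⟨k.1, c k.1 k.2, k.2, rfl⟩)
    (by rintro ⟨s, _, i, rfl⟩; exact ⟨⟨s, i⟩, rfl⟩)

/-- The filter `f` supplies closure under finite conjunction and weakening. Finitely many formulas
of `f` supported on `T` have a conjunction in `f`; quantifying out `k` gives a formula of `f`
supported on `S`, hence true at `c`. Saturation over `A` and the entries of `c` then finds one value
for all of them. -/
theorem IsSaturated.exists_updateAt {κ : Cardinal.{max u w}} (hsat : M.IsSaturated κ)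
    (hκ : ℵ₀ < κ) {A : M.Params} (hA : #(Σ s, A s) < κ) (hX : Countable (Σ s, X s))
    (f : Filter (M.Tuple X)) {S T : Set (Σ s, X s)} {k : Σ s, X s}
    (hST : ∀ j ∈ T, j ≠ k → j ∈ S) {c : M.Tuple X}
    (hc : ∀ ψ : M.FormulaOver A X, SupportedOn S ψ → {a | RealizeOver ψ a} ∈ f →
      RealizeOver ψ c) :
    ∃ e, ∀ ψ : M.FormulaOver A X, SupportedOn T ψ → {a | RealizeOver ψ a} ∈ f →
      RealizeOver ψ (updateAt c k e) := by
  let B : M.Params := fun s => A s ∪ range (c s)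
  have hB : #(Σ s, B s) < κ := by
    have h2 : #(Σ s, B s) ≤ #((Σ s, A s) ⊕ (Σ s, range (c s))) :=
      Cardinal.mk_le_of_surjective (f := Sum.elim (fun k => ⟨k.1, k.2.1, .inl k.2.2⟩)
        fun k => ⟨k.1, k.2.1, .inr k.2.2⟩) (by
          rintro ⟨s, e, he | he⟩
          exacts [⟨.inl ⟨s, e, he⟩, rfl⟩, ⟨.inr ⟨s, e, he⟩, rfl⟩])
    rw [Cardinal.mk_sum, Cardinal.lift_id, Cardinal.lift_id] at h2
    exact h2.trans_lt (Cardinal.add_lt_of_lt hκ.le hA ((mk_sigma_range_le_aleph0 hX c).trans_lt hκ))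
  let Φ : Set (M.FormulaOver B (Single k.1)) := {θ | ∃ ψ : M.FormulaOver A X,
    SupportedOn T ψ ∧ {a | RealizeOver ψ a} ∈ f ∧
      ∀ e, RealizeOver θ (single e) ↔ RealizeOver ψ (updateAt c k e)}
  obtain ⟨a, ha⟩ := hsat B hB k.1 Φ (by
    intro Ψ hΨ hfin
    have hΨ' (θ) : θ ∈ Ψ → θ ∈ Φ := @hΨ θ
    have : Nonempty (M.FormulaOver A X) := ⟨.falsum⟩
    choose! ψ h1 h2 h3 using hΨ'
    obtain ⟨χ, hχ⟩ := exists_realizeOver_iff_forall_mem (hfin.image ψ)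
    obtain ⟨η, hη⟩ := exists_realizeOver_iff_exists χ k
    have hχT : SupportedOn T χ := by
      intro a a' h
      rw [hχ, hχ]
      simp only [forall_mem_image]
      exact forall₂_congr fun θ hθ => h1 θ hθ a a' h
    have hχf : {a | RealizeOver χ a} ∈ f := by
      simp only [hχ, forall_mem_image]
      exact (Filter.eventually_all_finite hfin).2 fun θ hθ => h2 θ hθ
    obtain ⟨e, he⟩ := (hη c).1 <| hc η (hχT.of_realizeOver_iff_exists hη hST) <|
      Filter.mem_of_superset hχf fun a ha => (hη a).2 ⟨a k.1 k.2, by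
        refine (hχT _ _ fun j hj => ?_).1 ha
        by_cases hjk : j = k
        · subst hjk
          rw [updateAt_self]
        · rw [updateAt_of_ne _ hjk]⟩
    rw [hχ] at he
    exact ⟨single e, fun θ hθ => (h3 θ hθ e).2 (he _ (mem_image_of_mem _ hθ))⟩)
  refine ⟨a k.1 ⟨rfl⟩, fun ψ hψ hf => ?_⟩
  obtain ⟨θ, hθ⟩ := exists_realizeOver_single_iff (B := B) (fun _ => subset_union_left)
    (c := c) (fun _ i => .inr ⟨i, rfl⟩) ψ k
  rw [← hθ, ← eq_single]
  exact ha θ ⟨ψ, hψ, hf, hθ⟩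

/-- Saturation for countable tuples of variables. -/
theorem IsSaturated.exists_forall_realizeOver {κ : Cardinal.{max u w}} (hsat : M.IsSaturated κ)
    (hκ : ℵ₀ < κ) {A : M.Params} (hA : #(Σ s, A s) < κ) (hX : Countable (Σ s, X s))
    (Φ : Set (M.FormulaOver A X))
    (hΦ : ∀ Ψ ⊆ Φ, Ψ.Finite → ∃ a : M.Tuple X, ∀ φ ∈ Ψ, RealizeOver φ a) :
    ∃ a : M.Tuple X, ∀ φ ∈ Φ, RealizeOver φ a := by
  obtain ⟨enc, henc⟩ := exists_injective_nat (Σ s, X s)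
  let f : Filter (M.Tuple X) := Filter.generate ((fun φ => {a | RealizeOver φ a}) '' Φ)
  have hf : f.NeBot := by
    refine Filter.generate_neBot_iff.2 fun t ht hfin => ?_
    obtain ⟨Ψ, hΨ, hΨfin, rfl⟩ :=
      (exists_subset_image_finite_and (p := (· = t))).1 ⟨t, ht, hfin, rfl⟩
    obtain ⟨a, ha⟩ := hΦ Ψ hΨ hΨfin
    exact ⟨a, by simpa using ha⟩
  -- These are the variables settled before stage `n`; at stage `0` only formulas of constant truth
  -- value are concerned.
  let S (n : ℕ) : Set (Σ s, X s) := {k | enc k < n}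
  let Inv (n : ℕ) (c : M.Tuple X) : Prop := ∀ ψ : M.FormulaOver A X, SupportedOn (S n) ψ →
    {a | RealizeOver ψ a} ∈ f → RealizeOver ψ c
  have h0 : ∃ c, Inv 0 c := by
    obtain ⟨c, -⟩ := hΦ ∅ (empty_subset _) finite_empty
    refine ⟨c, fun ψ hψ hψf => ?_⟩
    obtain ⟨a, ha⟩ := hf.nonempty_of_mem hψf
    exact (hψ a c fun k hk => absurd hk (Nat.not_lt_zero _)).1 ha
  have step (n : ℕ) (c : M.Tuple X) (hc : Inv n c) :
      ∃ c', Inv (n + 1) c' ∧ ∀ k, enc k ≠ n → c' k.1 k.2 = c k.1 k.2 := by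
    by_cases hn : ∃ k, enc k = n
    · obtain ⟨k, rfl⟩ := hn
      obtain ⟨e, he⟩ := hsat.exists_updateAt hκ hA hX f (S := S (enc k)) (T := S (enc k + 1))
        (k := k) (fun j hj hjk => lt_of_le_of_ne (Nat.lt_succ_iff.1 hj) (henc.ne hjk)) hc
      exact ⟨_, he, fun j hj => updateAt_of_ne _ (fun h => hj (congrArg enc h)) _⟩
    -- No variable has code `n`, so nothing new has to be settled.
    · refine ⟨c, fun ψ hψ => hc ψ fun a a' h => hψ a a' fun k hk => h k ?_, fun _ _ => rfl⟩
      exact lt_of_le_of_ne (Nat.lt_succ_iff.1 hk) fun h => hn ⟨k, h⟩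
  obtain ⟨c₀, hc₀⟩ := h0
  choose! g hg hg' using step
  let c : ℕ → M.Tuple X := fun n => Nat.rec c₀ (fun n c => g n c) n
  have hc (n : ℕ) : Inv n (c n) := by
    induction n with
    | zero => exact hc₀
    | succ n ih => exact hg n _ ih
  have hstable (k) (n : ℕ) (hn : enc k < n) : c n k.1 k.2 = c (enc k + 1) k.1 k.2 := by
    induction n, hn using Nat.le_induction with
    | base => rfl
    | succ n hn ih => exact (hg' n _ (hc n) k (Nat.lt_of_succ_le hn).ne).trans ih
  -- A variable gets its final value at the stage after its code, and a formula is decided once its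
  -- finite support is settled.
  refine ⟨fun s i => c (enc ⟨s, i⟩ + 1) s i, fun φ hφ => ?_⟩
  obtain ⟨F, hF⟩ := exists_finset_supportedOn φ
  have hlt (k) (hk : k ∈ F) : enc k < F.sup enc + 1 := Nat.lt_succ_iff.2 (Finset.le_sup hk)
  refine (hF (c (F.sup enc + 1)) _ fun k hk => hstable k _ (hlt k hk)).1 ?_
  refine hc _ φ (fun a a' h => hF a a' fun k hk => h k (hlt k hk)) ?_
  exact Filter.mem_generate_of_mem (mem_image_of_mem _ hφ)

/-! ### Types over the empty set and homogeneity -/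

@[simp]
theorem realizeOver_map_inl {A : M.Params} (φ : L.Formula X) (a : M.Tuple X) :
    RealizeOver (A := A) (φ.map fun _ => Sum.inl) a ↔ M.Realize φ a :=
  realize_map _ _ _

theorem exists_realize_iff_realizeOver (φ : M.FormulaOver M.noParams X) :
    ∃ ψ : L.Formula X, ∀ a : M.Tuple X, M.Realize ψ a ↔ RealizeOver φ a := by
  refine ⟨φ.map fun s => Sum.elim id fun e => e.2.elim, fun a => ?_⟩
  rw [realize_map, RealizeOver]
  refine iff_of_eq (congrArg _ ?_)
  funext s i
  rcases i with i | i
  exacts [rfl, i.2.elim]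

theorem sameType_iff {a b : M.Tuple X} :
    SameType a b ↔ ∀ φ : L.Formula X, M.Realize φ a ↔ M.Realize φ b := by
  refine ⟨fun h φ => ?_, fun h => Set.ext fun φ => ?_⟩
  · rw [← realizeOver_map_inl (A := M.noParams), ← realizeOver_map_inl (A := M.noParams)]
    exact Set.ext_iff.1 h _
  · obtain ⟨ψ, hψ⟩ := exists_realize_iff_realizeOver φ
    exact (hψ a).symm.trans ((h ψ).trans (hψ b))

theorem sameType_act {g : ∀ s : L.Sorts, Equiv.Perm (M.carrier s)} (hg : g ∈ M.aut)
    (a : M.Tuple X) : SameType (act g a) a :=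
  sameType_iff.2 fun φ => realize_act hg φ a

/-- Sending each entry of `a` to the corresponding entry of `b` is well defined, because
coincidences between entries are part of the type, and it is elementary for the same reason. -/
theorem IsStronglyHomogeneous.exists_act_eq {κ : Cardinal.{max u w}}
    (hhom : M.IsStronglyHomogeneous κ) (hκ : ℵ₀ < κ) (hX : Countable (Σ s, X s))
    {a b : M.Tuple X} (h : SameType a b) : ∃ g ∈ M.aut, act g a = b := by
  rw [sameType_iff] at h
  let A : M.Params := fun s => range (a s)
  have hA : #(Σ s, A s) < κ :=
    (mk_sigma_range_le_aleph0 hX a).trans_lt hκ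
  let σ (s : L.Sorts) (e : A s) : X s := e.2.choose
  have hσ (s : L.Sorts) (e : A s) : a s (σ s e) = e.1 := e.2.choose_spec
  have hb (s : L.Sorts) (i j : X s) (hij : a s i = a s j) : b s i = b s j :=
    (h (.equal (.var (.inl i)) (.var (.inl j)))).1 hij
  obtain ⟨g, hg, hga⟩ := hhom A hA (fun s e => b s (σ s e)) fun φ => by
    have := h (φ.map σ)
    rw [realize_map, realize_map] at this
    rw [← this]
    exact iff_of_eq (congrArg _ (funext fun s => funext fun e => (hσ s e).symm))
  refine ⟨g, hg, funext fun s => funext fun i => ?_⟩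
  exact (congrFun (congrFun hga s) ⟨a s i, i, rfl⟩).trans (hb _ _ _ (hσ s ⟨a s i, i, rfl⟩))

/-! ### Elementary submodels -/

/-- The existential statement goes down to `N`; the instance found there, now a formula with
parameters only, goes back up. -/
theorem IsElementarySub.exists_mem_single {N : M.Params} (hN : M.IsElementarySub N)
    {s : L.Sorts} (φ : M.FormulaOver N (Single s)) {e : M.carrier s}
    (he : RealizeOver φ (single e)) : ∃ e ∈ N s, RealizeOver φ (single e) := by
  obtain ⟨hcl, h⟩ := hN
  obtain ⟨e', he'⟩ := (realize_exSingle φ _).1 <|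
    (h φ.exSingle).2 ((realize_exSingle φ _).2 ⟨e, he⟩)
  let τ (t : L.Sorts) : Concat (Single s) (M.paramVars N) t → M.paramVars N t :=
    Sum.elim (fun i => i.down ▸ e') id
  have h1 : (M.induced N hcl).Realize (φ.map τ) (fun _ e => e) := by
    refine (realize_map τ φ _).2 ((iff_of_eq (congrArg _ ?_)).2 he')
    funext t i
    rcases i with ⟨⟨rfl⟩⟩ | i <;> rfl
  have h2 := (h _).1 h1
  rw [realize_map] at h2
  refine ⟨e'.1, e'.2, ?_⟩
  rw [RealizeOver]
  convert h2 using 1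
  funext t i
  rcases i with ⟨⟨rfl⟩⟩ | i <;> rfl

/-- The finitely many relevant coordinates are quantified out one by one and then refilled inside
`N`. -/
theorem IsElementarySub.exists_mem {N : M.Params} (hN : M.IsElementarySub N)
    (φ : M.FormulaOver N X) {a : M.Tuple X} (ha : RealizeOver φ a) :
    ∃ c : M.Tuple X, (∀ s i, c s i ∈ N s) ∧ RealizeOver φ c := by
  classical
  obtain ⟨F, hF⟩ := exists_finset_supportedOn φ
  induction F using Finset.induction_on generalizing φ with
  | empty =>
    have (s : L.Sorts) (i : X s) : ∃ e, e ∈ N s :=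
      -- A true formula shows that `N` has points in every sort that occurs in the tuple.
      (hN.exists_mem_single (.imp .falsum .falsum) (e := a s i) id).imp fun _ h => h.1
    choose c hc using this
    exact ⟨c, hc, (hF a c fun k hk => absurd hk (by simp)).1 ha⟩
  | insert k F _ ih =>
    obtain ⟨ψ, hψ⟩ := exists_realizeOver_iff_exists φ k
    obtain ⟨c, hcN, hc⟩ := ih ψ ((hψ a).2 ⟨a k.1 k.2, by
      refine (hF _ _ fun j _ => ?_).1 ha
      by_cases hjk : j = k
      · subst hjk
        rw [updateAt_self]
      · rw [updateAt_of_ne _ hjk]⟩)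
      (hF.of_realizeOver_iff_exists hψ fun j hj hjk => by
        simpa [hjk] using hj)
    obtain ⟨e, he⟩ := (hψ c).1 hc
    obtain ⟨θ, hθ⟩ := exists_realizeOver_single_iff (fun s => Subset.rfl) hcN φ k
    obtain ⟨e', he'N, he'⟩ := hN.exists_mem_single θ ((hθ e).2 he)
    refine ⟨updateAt c k e', fun s i => ?_, (hθ e').1 he'⟩
    by_cases h : (⟨s, i⟩ : Σ s, X s) = k
    · subst h
      rwa [updateAt_self c ⟨s, i⟩]
    · rw [updateAt_of_ne c (j := ⟨s, i⟩) h]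
      exact hcN s i

theorem eval_induced {N : M.Params} (h) (a : (M.induced N h).Tuple X) {s : L.Sorts}
    (t : L.Term X s) : M.eval (fun s i => (a s i).1) t = ((M.induced N h).eval a t).1 := by
  induction t with
  | var i => rfl
  | app f ts ih => simp only [eval, ih]; rfl

theorem eval_concat_induced {N : M.Params} (h) {l : List L.Sorts}
    (b : (M.induced N h).Tuple (Bound l)) {s : L.Sorts}
    (t : L.Term (Concat (M.paramVars N) (Bound l)) s) :
    M.eval (M.concat (M.paramTuple N) fun s i => (b s i).1) t =
      ((M.induced N h).eval ((M.induced N h).concat (fun _ e => e) b) t).1 := by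
  refine Eq.trans (congrArg (M.eval · t) ?_) (eval_induced h _ t)
  funext s i
  cases i <;> rfl

/-- The Tarski–Vaught test. -/
theorem isElementarySub_of_exists_mem_single {N : M.Params}
    (hN : ∀ (s : L.Sorts) (φ : M.FormulaOver N (Single s)) (e : M.carrier s),
      RealizeOver φ (single e) → ∃ e ∈ N s, RealizeOver φ (single e)) :
    M.IsElementarySub N := by
  have hcl (d : List L.Sorts) (s : L.Sorts) (f : L.Func d s)
      (a : ∀ i : Fin d.length, M.carrier (d.get i)) (ha : ∀ i, a i ∈ N (d.get i)) :
      M.funMap f a ∈ N s := by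
    -- The formula `x = f(a)` has only one solution, which must therefore lie in `N`.
    obtain ⟨e, he, h⟩ := hN s (.equal (.var (.inl (.inl ⟨rfl⟩)))
      (.app f fun i => .var (.inl (.inr ⟨a i, ha i⟩)))) (M.funMap f a) rfl
    have h : e = M.funMap f a := h
    rwa [← h]
  refine ⟨hcl, fun φ => ?_⟩
  have key {l : List L.Sorts} (φ : L.BoundedFormula (M.paramVars N) l)
      (b : (M.induced N hcl).Tuple (Bound l)) :
      (M.induced N hcl).BRealize (fun _ e => e) φ b ↔
        M.BRealize (M.paramTuple N) φ fun s i => (b s i).1 := by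
    induction φ with
    | falsum => rfl
    | equal t₁ t₂ =>
      simp only [BRealize, eval_concat_induced]
      exact Subtype.ext_iff
    | rel R ts =>
      simp only [BRealize, eval_concat_induced]
      rfl
    | imp φ ψ ih₁ ih₂ => exact imp_congr (ih₁ b) (ih₂ b)
    | @all l s φ ih =>
      have hcons (e : N s) : (fun t i => ((M.induced N hcl).boundCons e b t i).1) =
          M.boundCons e.1 fun t i => (b t i).1 := by
        funext t i
        cases i <;> rfl
      have ih' (e : N s) := (ih ((M.induced N hcl).boundCons e b)).trans
        (iff_of_eq (congrArg _ (hcons e)))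
      refine ⟨fun H e => ?_, fun H e => (ih' e).2 (H e.1)⟩
      by_contra he
      -- The quantified variable becomes free, and the outer bound variables become the parameters
      -- `b` from `N`.
      let σ : ∀ t, Concat (M.paramVars N) (Bound (s :: l)) t →
          Concat (Concat (Single s) (M.paramVars N)) (Bound []) t
        | _, .inl i => .inl (.inr i)
        | _, .inr .zero => .inl (.inl ⟨rfl⟩)
        | _, .inr (.succ i) => .inl (.inr (b _ i))
      have hσ (e : M.carrier s) :
          RealizeOver (A := N) (Formula.not (φ.rename σ)) (single e) ↔
            ¬ M.BRealize (M.paramTuple N) φ (M.boundCons e fun t i => (b t i).1) := by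
        refine not_congr (bRealize_rename σ φ fun t i => ?_)
        match t, i with
        | _, .inl i => rfl
        | _, .inr .zero => rfl
        | _, .inr (.succ i) => rfl
      obtain ⟨e', he'N, he'⟩ := hN s _ e ((hσ e).2 he)
      exact (hσ e').1 he' ((ih' ⟨e', he'N⟩).1 (H ⟨e', he'N⟩))
  refine (key φ _).trans (iff_of_eq (congrArg _ ?_))
  funext t i
  nomatch i

variable (M) in
/-- An increasing sequence of parameter sets: it starts with a point of each nonempty sort, and at
each step it adds a solution of each formula in one variable over the preceding set that has one. -/
noncomputable def skolemHull : ℕ → M.Params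
  | 0 => fun s => {e | ∃ h : Nonempty (M.carrier s), e = h.some}
  | n + 1 => fun s => skolemHull n s ∪
      range fun φ : {φ : M.FormulaOver (skolemHull n) (Single s) // ∃ e, RealizeOver φ (single e)} =>
        φ.2.choose

theorem skolemHull_mono (s : L.Sorts) : Monotone fun n => M.skolemHull n s :=
  monotone_nat_of_le_succ fun _ => subset_union_left

theorem countable_single (s : L.Sorts) : Countable (Σ t, Single s t) :=
  Function.Injective.countable (β := Unit) (f := fun _ => ())
    (by rintro ⟨_, ⟨rfl⟩⟩ ⟨_, ⟨rfl⟩⟩ _; rfl)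

theorem countable_skolemHull (hL : L.IsCountable) (n : ℕ) (s : L.Sorts) :
    (M.skolemHull n s).Countable := by
  induction n generalizing s with
  | zero => exact Set.Subsingleton.countable fun a ⟨_, ha⟩ b ⟨_, hb⟩ => ha.trans hb.symm
  | succ n ih =>
    have := hL.1
    have hn : Countable (Σ t, M.paramVars (M.skolemHull n) t) :=
      have (t : L.Sorts) : Countable (M.paramVars (M.skolemHull n) t) := (ih t).to_subtype
      inferInstance
    have : Countable (M.FormulaOver (M.skolemHull n) (Single s)) :=
      BoundedFormula.countable hL (countable_concat (countable_single s) hn) _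
    exact (ih s).union (countable_range _)

/-- The downward Löwenheim–Skolem theorem. -/
theorem exists_isElementarySub_countable (hL : L.IsCountable) :
    ∃ N : M.Params, M.IsElementarySub N ∧ Countable (Σ s, N s) := by
  classical
  have := hL.1
  let N : M.Params := fun s => ⋃ n, M.skolemHull n s
  refine ⟨N, isElementarySub_of_exists_mem_single fun s φ e he => ?_, ?_⟩
  · obtain ⟨F, hF⟩ := exists_finset_realize_congr (M := M) φ
    have hk (k : Σ t, Concat (Single s) (M.paramVars N) t) :
        ∃ n, ∀ c, k.2 = .inr c → c.1 ∈ M.skolemHull n k.1 := by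
      rcases k with ⟨t, i | c⟩
      · exact ⟨0, fun c hc => nomatch hc⟩
      · obtain ⟨n, hn⟩ := mem_iUnion.1 c.2
        exact ⟨n, fun c' hc => by cases hc; exact hn⟩
    choose n hn using hk
    let m := F.sup n
    have hne (t : L.Sorts) (c : M.paramVars N t) :
        (⟨c.1⟩ : Nonempty (M.carrier t)).some ∈ M.skolemHull m t :=
      skolemHull_mono t (Nat.zero_le m) ⟨_, rfl⟩
    -- Parameters outside stage `m` do not affect the truth of `φ`; they go to the default point of
    -- their sort, present since stage `0`.
    let σ (t : L.Sorts) (c : M.paramVars N t) : M.paramVars (M.skolemHull m) t :=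
      if h : c.1 ∈ M.skolemHull m t then ⟨c.1, h⟩ else ⟨_, hne t c⟩
    have hσ (e : M.carrier s) : RealizeOver (A := M.skolemHull m)
        (φ.map fun t => Sum.map id (σ t)) (single e) ↔ RealizeOver φ (single e) := by
      rw [RealizeOver, realize_map]
      refine hF _ _ ?_
      rintro ⟨t, i | c⟩ hk
      · rfl
      · have hc : c.1 ∈ M.skolemHull m t :=
          skolemHull_mono t (Finset.le_sup hk) (hn ⟨t, .inr c⟩ c rfl)
        simp [concat, paramTuple, σ, hc]
    have hex : ∃ e, RealizeOver (A := M.skolemHull m)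
        (φ.map fun t => Sum.map id (σ t)) (single e) := ⟨e, (hσ e).2 he⟩
    exact ⟨hex.choose, mem_iUnion.2 ⟨m + 1, .inr ⟨⟨_, hex⟩, rfl⟩⟩, (hσ _).1 hex.choose_spec⟩
  · have (s : L.Sorts) : Countable (N s) :=
      (countable_iUnion fun n => countable_skolemHull hL n s).to_subtype
    infer_instance

end SortedLanguage.Str

namespace SortedLanguage.Str

variable {L : SortedLanguage.{u, v}} {M : Str.{u, v, w} L}

section

variable {X : L.Sorts → Type x} {Y : L.Sorts → Type y}

/-! ### Type spaces -/

theorem exists_surjective_formula (hL : L.IsCountable) (hX : Countable (Σ s, X s)) :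
    ∃ χ : ℕ → L.Formula X, Function.Surjective χ :=
  have := BoundedFormula.countable hL hX []
  have : Nonempty (L.Formula X) := ⟨.falsum⟩
  exists_surjective_nat _

theorem isOpen_setOf_mem {A : M.Params} (φ : M.FormulaOver A X) :
    IsOpen {p : TypeSpace M X A | φ ∈ p.1} :=
  TopologicalSpace.isOpen_generateFrom_of_mem ⟨φ, rfl⟩

theorem isClosed_setOf_mem {A : M.Params} (φ : M.FormulaOver A X) :
    IsClosed {p : TypeSpace M X A | φ ∈ p.1} := by
  refine isOpen_compl_iff.1 ?_
  convert isOpen_setOf_mem (Formula.not φ) using 1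
  ext ⟨_, a, rfl⟩
  rfl

theorem mem_realisations_toType {a b : M.Tuple X} :
    a ∈ (toType M.noParams b).realisations ↔ SameType a b :=
  Subtype.ext_iff

theorem not_sameType_iff {a b : M.Tuple X} :
    ¬ SameType a b ↔ ∃ φ : L.Formula X, M.Realize φ b ∧ ¬ M.Realize φ a := by
  rw [sameType_iff, not_forall]
  refine ⟨fun ⟨φ, hφ⟩ => ?_, fun ⟨φ, h⟩ => ⟨φ, fun h' => h.2 (h'.2 h.1)⟩⟩
  by_cases hb : M.Realize φ b
  · exact ⟨φ, hb, fun ha => hφ (iff_of_true ha hb)⟩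
  · exact ⟨φ.not, hb, fun ha => hφ (iff_of_false ha hb)⟩

theorem isIsolated_of_forall_sameType {a : M.Tuple X} {φ : L.Formula X} (ha : M.Realize φ a)
    (h : ∀ b, M.Realize φ b → SameType b a) : (toType M.noParams a).IsIsolated := by
  rw [TypeSpace.IsIsolated]
  convert isOpen_setOf_mem (A := M.noParams) (φ.map fun _ => Sum.inl) using 1
  ext ⟨_, b, rfl⟩
  refine ⟨fun hb => ?_, fun hb => Subtype.ext (h b ((realizeOver_map_inl φ b).1 hb))⟩
  rw [mem_singleton_iff.1 hb]
  exact (realizeOver_map_inl φ a).2 ha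

theorem isFSigma_of_forall_mem_iff {A : M.Params} {D : Set (M.Tuple X)}
    (F : ℕ → Set (TypeSpace M X A)) (hF : ∀ n, IsClosed (F n))
    (h : ∀ a, a ∈ D ↔ ∃ n, toType A a ∈ F n) : IsFSigma A D := by
  refine ⟨F, hF, ?_⟩
  ext p
  rw [mem_iUnion]
  constructor
  · rintro ⟨a, ha, rfl⟩
    exact (h a).1 ha
  · obtain ⟨_, a, rfl⟩ := p
    exact fun hp => ⟨a, (h a).2 hp, rfl⟩

/-! ### Relations defined by a formula -/

/-- The formula `φ` defines the relation `E`. -/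
def DefinesRel (M : Str.{u, v, w} L) (φ : L.Formula (Concat X X))
    (E : M.Tuple X → M.Tuple X → Prop) : Prop :=
  ∀ a b, M.Realize φ (M.concat a b) ↔ E a b

theorem concat_eta (c : M.Tuple (Concat X Y)) :
    M.concat (fun s i => c s (.inl i)) (fun s i => c s (.inr i)) = c := by
  funext s i
  cases i <;> rfl

theorem exists_definesRel {E : M.Tuple X → M.Tuple X → Prop}
    (hdef : IsDefinable M.noParams (relSet E)) :
    ∃ φ : L.Formula (Concat X X), DefinesRel M φ E := by
  obtain ⟨φ, hφ⟩ := hdef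
  obtain ⟨ψ, hψ⟩ := exists_realize_iff_realizeOver φ
  exact ⟨ψ, fun a b => (hψ _).trans (Set.ext_iff.1 hφ _).symm⟩

theorem DefinesRel.exists_realizeOver_iff {E : M.Tuple X → M.Tuple X → Prop}
    {φ : L.Formula (Concat X X)} (hφ : DefinesRel M φ E) {A : M.Params} {c : M.Tuple X}
    (hc : ∀ s i, c s i ∈ A s) : ∃ ψ : M.FormulaOver A X, ∀ a, RealizeOver ψ a ↔ E c a := by
  refine ⟨φ.map fun s => Sum.elim (fun i => .inr ⟨c s i, hc s i⟩) .inl, fun a => ?_⟩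
  rw [RealizeOver, realize_map, ← hφ]
  refine iff_of_eq (congrArg _ ?_)
  funext s i
  cases i <;> rfl

theorem DefinesRel.isInvariantRel {E : M.Tuple X → M.Tuple X → Prop}
    {φ : L.Formula (Concat X X)} (hφ : DefinesRel M φ E) : IsInvariantRel E := by
  intro g hg a b
  rw [← hφ, ← hφ, ← act_concat, realize_act hg]

/-- If the class of `a` missed `N`, then `a` would avoid all of the finitely many classes that meet
`N`. This is a formula over `N`, so some tuple of `N` would avoid them too, including its own class.
-/
theorem IsElementarySub.exists_mem_rel {N : M.Params} (hN : M.IsElementarySub N)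
    {E : M.Tuple X → M.Tuple X → Prop} (hE : Equivalence E) {φ : L.Formula (Concat X X)}
    (hφ : DefinesRel M φ E) (hfin : (classes E).Finite) (a : M.Tuple X) :
    ∃ c : M.Tuple X, (∀ s i, c s i ∈ N s) ∧ E c a := by
  by_contra! ha
  have hK (C : Set (M.Tuple X)) : ∃ ψ : M.FormulaOver N X, RealizeOver ψ a ∧
      ∀ c ∈ C, (∀ s i, c s i ∈ N s) → C ∈ classes E → ¬ RealizeOver ψ c := by
    by_cases hC : ∃ c ∈ C, (∀ s i, c s i ∈ N s) ∧ C ∈ classes E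
    · obtain ⟨c, hcC, hcN, d, rfl⟩ := hC
      obtain ⟨ψ, hψ⟩ := hφ.exists_realizeOver_iff hcN
      exact ⟨Formula.not ψ, fun h => ha c hcN ((hψ a).1 h), fun c' hc' _ _ h =>
        h ((hψ c').2 (hE.trans (hE.symm hcC) hc'))⟩
    · push Not at hC
      exact ⟨.imp .falsum .falsum, id, fun c hc hcN h => absurd h (hC c hc hcN)⟩
  choose ψ hψa hψ using hK
  obtain ⟨χ, hχ⟩ := exists_realizeOver_iff_forall_mem (hfin.image ψ)
  simp only [forall_mem_image] at hχ
  obtain ⟨c, hcN, hc⟩ := hN.exists_mem χ ((hχ a).2 fun C _ => hψa C)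
  exact hψ {b | E c b} c (hE.refl c) hcN ⟨c, rfl⟩ ((hχ c).1 hc ⟨c, rfl⟩)

/-- If no element of the `E`-class of `d` has the type of `a`, a formula separates them. -/
theorem IsSaturated.exists_realize_forall_not {κ : Cardinal.{max u w}} (hsat : M.IsSaturated κ)
    (hκ : ℵ₀ < κ) (hX : Countable (Σ s, X s)) {E : M.Tuple X → M.Tuple X → Prop}
    {φ : L.Formula (Concat X X)} (hφ : DefinesRel M φ E) {a d : M.Tuple X}
    (h : ∀ b, E d b → ¬ SameType b a) :
    ∃ θ : L.Formula X, M.Realize θ a ∧ ∀ b, E d b → ¬ M.Realize θ b := by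
  by_contra! hθ
  obtain ⟨ε, hε⟩ := hφ.exists_realizeOver_iff (A := fun s => range (d s)) fun s i => ⟨i, rfl⟩
  obtain ⟨b, hb⟩ := hsat.exists_forall_realizeOver hκ
    ((mk_sigma_range_le_aleph0 hX d).trans_lt hκ) hX
    (insert ε ((fun θ : L.Formula X => θ.map fun _ => Sum.inl) '' {θ | M.Realize θ a})) (by
      intro Ψ hΨ hfin
      -- A true formula is assigned to the condition `E(d, x)`, which is carried separately, so that
      -- only formulas true of `a` have to be conjoined.
      have hχ (ψ) (hψ : ψ ∈ Ψ) : ∃ χ : L.Formula X, M.Realize χ a ∧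
          ∀ b, M.Realize χ b → E d b → RealizeOver ψ b := by
        rcases hΨ hψ with rfl | ⟨χ, hχ, rfl⟩
        · exact ⟨.imp .falsum .falsum, id, fun b _ hb => (hε b).2 hb⟩
        · exact ⟨χ, hχ, fun b hb _ => (realizeOver_map_inl χ b).2 hb⟩
      have : Nonempty (L.Formula X) := ⟨.falsum⟩
      choose! χ hχa hχ using hχ
      obtain ⟨θ, hθ'⟩ := exists_realize_iff_forall_mem (M := M) (hfin.image χ)
      simp only [forall_mem_image] at hθ'
      obtain ⟨b, hb, hbθ⟩ := hθ θ ((hθ' a).2 fun ψ hψ => hχa ψ hψ)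
      exact ⟨b, fun ψ hψ => hχ ψ hψ b ((hθ' b).1 hbθ hψ) hb⟩)
  rw [forall_mem_insert, forall_mem_image] at hb
  refine h b ((hε b).1 hb.1) (by_contra fun hab => ?_)
  obtain ⟨θ, hθa, hθb⟩ := not_sameType_iff.1 hab
  exact hθb ((realizeOver_map_inl θ b).1 (hb.2 hθa))

/-- Near a realisation `a` of a non-isolated type there are realisations of other types in the
same class of a definable equivalence relation with finitely many classes. -/
theorem exists_realize_rel_not_sameType {κ : Cardinal.{max u w}} (hsat : M.IsSaturated κ)
    (hhom : M.IsStronglyHomogeneous κ) (hκ : ℵ₀ < κ) (hX : Countable (Σ s, X s))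
    {E : M.Tuple X → M.Tuple X → Prop} (hE : Equivalence E) {ε : L.Formula (Concat X X)}
    (hε : DefinesRel M ε E) (hfin : (classes E).Finite) {a : M.Tuple X}
    (ha : ¬ (toType M.noParams a).IsIsolated) {φ : L.Formula X} (hφ : M.Realize φ a) :
    ∃ b, M.Realize φ b ∧ E b a ∧ ¬ SameType b a := by
  by_contra! h
  -- A formula true of `a` rules out each class without realisations of the type; by finiteness one
  -- conjunction rules them all out.
  have hC (C : Set (M.Tuple X)) : ∃ θ : L.Formula X, M.Realize θ a ∧
      (C ∈ classes E → (∀ b ∈ C, ¬ SameType b a) → ∀ b ∈ C, ¬ M.Realize θ b) := by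
    by_cases hC : C ∈ classes E ∧ ∀ b ∈ C, ¬ SameType b a
    · obtain ⟨⟨d, rfl⟩, hd⟩ := hC
      obtain ⟨θ, hθa, hθ⟩ := hsat.exists_realize_forall_not hκ hX hε hd
      exact ⟨θ, hθa, fun _ _ => hθ⟩
    · exact ⟨.imp .falsum .falsum, id, fun h1 h2 => absurd ⟨h1, h2⟩ hC⟩
  choose θ hθa hθ using hC
  obtain ⟨χ, hχ⟩ := exists_realize_iff_forall_mem (M := M) (hfin.image θ)
  simp only [forall_mem_image] at hχ
  refine ha (isIsolated_of_forall_sameType (φ := φ.and χ)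
    ((realize_and _ _ _).2 ⟨hφ, (hχ a).2 fun C _ => hθa C⟩) fun b hb => ?_)
  rw [realize_and, hχ] at hb
  -- So the class of `b` contains a realisation `c` of the type. An automorphism taking `c` to `a`
  -- moves `b` into the class of `a`, where `h` applies, without changing its type.
  obtain ⟨c, hbc, hca⟩ : ∃ c, E b c ∧ SameType c a := by
    by_contra! hc
    exact hθ {c | E b c} ⟨b, rfl⟩ hc b (hE.refl b) (hb.2 ⟨b, rfl⟩)
  obtain ⟨g, hg, rfl⟩ := hhom.exists_act_eq hκ hX hca
  have := h (act g b) ((realize_act hg _ _).2 hb.1) ((hε.isInvariantRel g hg _ _).2 hbc)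
  exact (sameType_act hg b).symm.trans this

end

/-! ### Finiteness of the set of classes -/

variable {X : L.Sorts → Type}

/-- A bounded definable equivalence relation has finitely many classes. -/
theorem IsSaturated.finite_classes {κ : Cardinal.{max u w}} (hsat : M.IsSaturated κ)
    (hκ : ℵ₀ < κ) (hX : Countable (Σ s, X s)) {E : M.Tuple X → M.Tuple X → Prop}
    (hE : Equivalence E) {φ : L.Formula (Concat X X)} (hφ : DefinesRel M φ E)
    (hbdd : #(classes E) < κ) : (classes E).Finite := by
  by_contra hinf
  have := Set.infinite_coe_iff.2 hinf
  choose r hr using fun C : classes E => C.2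
  let A : M.Params := fun s => range fun k : classes E × X s => r k.1 s k.2
  have hA : #(Σ s, A s) < κ := by
    have h1 : #(Σ s, A s) ≤ #(classes E × ULift.{w} (Σ s, X s)) :=
      Cardinal.mk_le_of_surjective
        (f := fun k => ⟨k.2.down.1, r k.1 k.2.down.1 k.2.down.2, (k.1, k.2.down.2), rfl⟩) (by
          rintro ⟨s, _, ⟨C, i⟩, rfl⟩
          exact ⟨(C, ⟨⟨s, i⟩⟩), rfl⟩)
    refine h1.trans_lt ?_
    rw [Cardinal.mk_prod, Cardinal.lift_id, Cardinal.lift_id]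
    refine Cardinal.mul_lt_of_lt hκ.le hbdd (lt_of_le_of_lt ?_ hκ)
    exact Cardinal.mk_le_aleph0_iff.2 inferInstance
  choose ψ hψ using fun C : classes E =>
    hφ.exists_realizeOver_iff (A := A) (c := r C) fun s i => ⟨(C, i), rfl⟩
  obtain ⟨a, ha⟩ := hsat.exists_forall_realizeOver hκ hA hX
    ((fun C => Formula.not (ψ C)) '' univ) (by
      intro Ψ hΨ hfin
      obtain ⟨K, -, hK, rfl⟩ :=
        (exists_subset_image_finite_and (p := (· = Ψ))).1 ⟨Ψ, hΨ, hfin, rfl⟩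
      -- Finitely many classes do not exhaust an infinite set, and the representative of another
      -- class avoids them.
      obtain ⟨C, hC⟩ := hK.exists_notMem
      refine ⟨r C, forall_mem_image.2 fun C' hC' h => hC ?_⟩
      have hCC : E (r C') (r C) := (hψ C' (r C)).1 h
      have : C' = C := by
        refine Subtype.ext ?_
        rw [← hr C', ← hr C]
        ext b
        exact ⟨hE.trans (hE.symm hCC), hE.trans hCC⟩
      exact this ▸ hC')
  have h1 := ha _ (mem_image_of_mem _ (mem_univ ⟨{b | E a b}, a, rfl⟩))
  refine h1 ((hψ _ a).2 (hE.symm ?_))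
  have h2 := hr ⟨{b | E a b}, a, rfl⟩
  exact (Set.ext_iff.1 h2 (r ⟨{b | E a b}, a, rfl⟩)).1 (hE.refl _)

/-! ### The relation `cutRel` -/

variable {E : M.Tuple X → M.Tuple X → Prop} {a₀ : M.Tuple X}

theorem cutRel_toType_iff {a b : M.Tuple X} :
    cutRel E (toType M.noParams a₀) a b ↔ (SameType a a₀ → E a b) ∧ SameType a b := by
  rw [cutRel, mem_realisations_toType, or_comm, ← imp_iff_not_or]

theorem equivalence_cutRel (hE : Equivalence E) :
    Equivalence (cutRel E (toType M.noParams a₀)) := by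
  simp only [funext fun a => funext fun b => propext (cutRel_toType_iff (E := E) (a₀ := a₀)
    (a := a) (b := b))]
  exact ⟨fun a => ⟨fun _ => hE.refl a, rfl⟩,
    fun h => ⟨fun hb => hE.symm (h.1 (h.2.trans hb)), h.2.symm⟩,
    fun h h' => ⟨fun ha => hE.trans (h.1 ha) (h'.1 (h.2.symm.trans ha)), h.2.trans h'.2⟩⟩

theorem isInvariantRel_cutRel (hE : IsInvariantRel E) :
    IsInvariantRel (cutRel E (toType M.noParams a₀)) := by
  intro g hg a b
  have h (c d : M.Tuple X) : SameType (act g c) d ↔ SameType c d :=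
    ⟨(sameType_act hg c).symm.trans, (sameType_act hg c).trans⟩
  have h' (c d : M.Tuple X) : SameType c (act g d) ↔ SameType c d :=
    ⟨fun k => k.trans (sameType_act hg d), fun k => k.trans (sameType_act hg d).symm⟩
  rw [cutRel_toType_iff, cutRel_toType_iff, hE g hg, h, h, h']

/-- A representative's type, coded by a set of natural numbers, and its `E`-class determine the
class. -/
theorem mk_classes_cutRel_lt {κ : Cardinal.{max u w}} (hL : L.IsCountable)
    (hX : Countable (Σ s, X s)) (hκ : continuum < κ) (hE : Equivalence E)
    (hbdd : #(classes E) < κ) : #(classes (cutRel E (toType M.noParams a₀))) < κ := by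
  obtain ⟨χ, hχ⟩ := exists_surjective_formula hL hX
  choose r hr using fun C : classes (cutRel E (toType M.noParams a₀)) => C.2
  have key : Function.Injective fun C : classes (cutRel E (toType M.noParams a₀)) =>
      (({n | M.Realize (χ n.down) (r C)}, ⟨{b | E (r C) b}, r C, rfl⟩) :
        Set (ULift.{max u w} ℕ) × classes E) := by
    intro C C' h
    rw [Prod.mk.injEq] at h
    have h1 : SameType (r C) (r C') := sameType_iff.2 fun φ => by
      obtain ⟨n, rfl⟩ := hχ φ
      exact Set.ext_iff.1 h.1 ⟨n⟩
    have h2 : E (r C) (r C') := (Set.ext_iff.1 (Subtype.ext_iff.1 h.2) (r C')).2 (hE.refl _)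
    have h3 := (cutRel_toType_iff (a₀ := a₀)).2 ⟨fun _ => h2, h1⟩
    have heq := equivalence_cutRel (a₀ := a₀) hE
    refine Subtype.ext ?_
    rw [← hr C, ← hr C']
    ext b
    exact ⟨heq.trans (heq.symm h3), heq.trans h3⟩
  refine (Cardinal.mk_le_of_injective key).trans_lt ?_
  rw [Cardinal.mk_prod, Cardinal.lift_id, Cardinal.lift_id]
  refine Cardinal.mul_lt_of_lt (aleph0_le_continuum.trans hκ.le) ?_ hbdd
  simpa using hκ

theorem isFSigma_cutRel (hL : L.IsCountable) (hX : Countable (Σ s, X s))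
    {ε : L.Formula (Concat X X)} (hε : DefinesRel M ε E) :
    IsFSigma M.noParams (relSet (cutRel E (toType M.noParams a₀))) := by
  obtain ⟨χ, hχ⟩ := exists_surjective_formula hL hX
  let emb (φ : L.Formula (Concat X X)) : M.FormulaOver M.noParams (Concat X X) :=
    φ.map fun _ => Sum.inl
  let φ₁ (φ : L.Formula X) : L.Formula (Concat X X) := φ.map fun _ => Sum.inl
  let φ₂ (φ : L.Formula X) : L.Formula (Concat X X) := φ.map fun _ => Sum.inr
  refine isFSigma_of_forall_mem_iff
    (fun n => ({q | emb ε ∈ q.1} ∪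
        -- The last set is everything or empty according to whether `χ n` belongs to the type of
        -- `a₀`, so only formulas of that type contribute.
        ({q | emb (φ₁ (χ n)).not ∈ q.1} ∩ {_q | M.Realize (χ n) a₀})) ∩
      ⋂ φ : L.Formula X, {q | emb ((φ₁ φ).iff (φ₂ φ)) ∈ q.1})
    (fun n => ((isClosed_setOf_mem _).union ((isClosed_setOf_mem _).inter isClosed_const)).inter
      (isClosed_iInter fun φ => isClosed_setOf_mem _)) fun c => ?_
  have hmem (φ : L.Formula (Concat X X)) :
      emb φ ∈ (toType M.noParams c).1 ↔ M.Realize φ c := realizeOver_map_inl φ c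
  simp only [mem_inter_iff, mem_union, mem_iInter, mem_ofPred_eq, hmem, realize_iff, realize_not,
    φ₁, φ₂, realize_map, exists_and_right]
  have hεc := hε (fun s i => c s (.inl i)) (fun s i => c s (.inr i))
  rw [concat_eta] at hεc
  rw [relSet, mem_ofPred_eq, cutRel_toType_iff, ← sameType_iff, hεc, exists_or, imp_iff_not_or,
    or_comm, not_sameType_iff, hχ.exists, exists_const]
  simp only [and_comm]

theorem isSmoothRel_cutRel (hL : L.IsCountable) (hX : Countable (Σ s, X s)) (hE : Equivalence E)
    {ε : L.Formula (Concat X X)} (hε : DefinesRel M ε E) (hfin : (classes E).Finite)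
    {N : M.Params} (hN : M.IsElementarySub N) (hcount : Countable (Σ s, N s)) :
    IsSmoothRel (onTypes N (cutRel E (toType M.noParams a₀))) := by
  classical
  obtain ⟨χ, hχ⟩ := exists_surjective_formula hL hX
  obtain ⟨ψ, hψ⟩ : ∃ ψ : ℕ → M.FormulaOver N X, Function.Surjective ψ :=
    exists_surjective_formula hL (countable_concat hX hcount)
  let emb (φ : L.Formula X) : M.FormulaOver N X := φ.map fun _ => Sum.inl
  let f (p : TypeSpace M X N) : ℕ ⊕ ℕ → Bool := Sum.elim
    (fun n => decide (emb (χ n) ∈ p.1))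
    -- These bits record which `E`-invariant formulas over `N` hold. Off the type of `a₀` they all
    -- vanish, so `E` is not seen there.
    (fun n => decide ((∀ m, emb (χ m) ∈ p.1 ↔ M.Realize (χ m) a₀) ∧
      (∀ a b, E a b → (RealizeOver (ψ n) a ↔ RealizeOver (ψ n) b)) ∧ ψ n ∈ p.1))
  refine ⟨ℕ ⊕ ℕ → Bool, inferInstance, ⟨⟩, f, ?_, ?_⟩
  · rw [← BorelSpace.measurable_eq (α := ℕ ⊕ ℕ → Bool)]
    let : MeasurableSpace (TypeSpace M X N) := borel _
    have : BorelSpace (TypeSpace M X N) := ⟨rfl⟩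
    have hmeas (φ : M.FormulaOver N X) : MeasurableSet {p : TypeSpace M X N | φ ∈ p.1} :=
      (isOpen_setOf_mem φ).measurableSet
    have hdecide (Q : TypeSpace M X N → Prop) [DecidablePred Q] (hQ : MeasurableSet {p | Q p}) :
        Measurable fun p => decide (Q p) := measurable_to_bool <| by
      convert hQ using 1
      ext
      simp
    refine measurable_pi_iff.2 ?_
    rintro (n | n)
    · exact hdecide _ (hmeas _)
    · refine hdecide _ ?_
      rw [ofPred_and, ofPred_and, ofPred_forall]
      refine .inter ?_ (.inter (.const _) (hmeas _))
      refine .iInter fun m => ?_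
      by_cases h : M.Realize (χ m) a₀
      · simp only [h, iff_true]
        exact hmeas _
      · simp only [h, iff_false]
        exact (hmeas _).compl
  -- This holds for arbitrary tuples, so the induced relation on types over `N` does not depend on
  -- the chosen realisations.
  have key (a b : M.Tuple X) : cutRel E (toType M.noParams a₀) a b ↔
      f (toType N a) = f (toType N b) := by
    have hemb (c : M.Tuple X) (φ : L.Formula X) :
        emb φ ∈ (toType N c).1 ↔ M.Realize φ c := realizeOver_map_inl φ c
    have hmem (c : M.Tuple X) (φ : M.FormulaOver N X) :
        φ ∈ (toType N c).1 ↔ RealizeOver φ c := Iff.rfl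
    have htype (c d : M.Tuple X) :
        (∀ m, M.Realize (χ m) c ↔ M.Realize (χ m) d) ↔ SameType c d := by
      rw [sameType_iff, hχ.forall]
    rw [cutRel_toType_iff, funext_iff, Sum.forall]
    simp only [f, Sum.elim_inl, Sum.elim_inr, decide_eq_decide, hemb, htype, hmem]
    constructor
    · rintro ⟨h1, h2⟩
      have hab : SameType a a₀ ↔ SameType b a₀ := ⟨h2.symm.trans, h2.trans⟩
      refine ⟨h2, fun n => ?_⟩
      rw [hab]
      exact and_congr_right fun hb => and_congr_right fun hn => hn a b (h1 (hab.2 hb))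
    · rintro ⟨h1, h2⟩
      refine ⟨fun ha => ?_, h1⟩
      -- With `c` in `N`, the formula `E(c, x)` is one of the recorded invariant formulas, and it
      -- identifies the class.
      obtain ⟨c, hcN, hca⟩ := hN.exists_mem_rel hE hε hfin a
      obtain ⟨θ, hθ⟩ := hε.exists_realizeOver_iff hcN
      obtain ⟨n, rfl⟩ := hψ θ
      have hinv (x y) (hxy : E x y) : RealizeOver (ψ n) x ↔ RealizeOver (ψ n) y := by
        rw [hθ, hθ]
        exact ⟨fun h => hE.trans h hxy, fun h => hE.trans h (hE.symm hxy)⟩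
      have hcb := ((h2 n).1 ⟨ha, hinv, (hθ a).2 hca⟩).2.2
      exact hE.trans (hE.symm hca) ((hθ b).1 hcb)
  rintro p q
  constructor
  · rintro ⟨a, rfl, b, rfl, h⟩
    exact (key a b).1 h
  · obtain ⟨_, a, rfl⟩ := p
    obtain ⟨_, b, rfl⟩ := q
    exact fun h => ⟨a, rfl, b, rfl, (key a b).2 h⟩

/-! ### Failure of type-definability, and orbitality -/

theorem not_isTypeDefinable_cutRel {κ : Cardinal.{max u w}} (hsat : M.IsSaturated κ)
    (hhom : M.IsStronglyHomogeneous κ) (hκ : ℵ₀ < κ) (hX : Countable (Σ s, X s))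
    (hE : Equivalence E) {ε : L.Formula (Concat X X)} (hε : DefinesRel M ε E)
    (hfin : (classes E).Finite) (ha₀ : ¬ (toType M.noParams a₀).IsIsolated) {b₀ : M.Tuple X}
    (hb₀ : SameType a₀ b₀) (hab : ¬ E a₀ b₀) :
    ¬ IsTypeDefinable M.noParams (relSet (cutRel E (toType M.noParams a₀))) := by
  rintro ⟨Φ, hΦ⟩
  obtain ⟨g, hg, rfl⟩ := hhom.exists_act_eq hκ hX hb₀
  -- By invariance `g` carries the class of `a₀` to the different class of `g a₀`.
  have hnear (b : M.Tuple X) (hb : E b a₀) : ¬ E b (act g b) := fun h =>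
    hab <| hE.trans (hE.symm hb) <| hE.trans h <| (hε.isInvariantRel g hg _ _).2 hb
  let emb (φ : L.Formula (Concat X X)) : M.FormulaOver M.noParams (Concat X X) :=
    φ.map fun _ => Sum.inl
  let φ₁ (φ : L.Formula X) : L.Formula (Concat X X) := φ.map fun _ => Sum.inl
  obtain ⟨c, hc⟩ := hsat.exists_forall_realizeOver hκ (A := M.noParams)
    (by simpa using aleph0_pos.trans hκ) (countable_concat hX hX)
    (insert (emb ε.not) ((fun φ => emb (φ₁ φ)) '' {φ | M.Realize φ a₀} ∪ Φ)) (by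
      intro Ψ hΨ hΨfin
      -- The pairs `(b, g b)` satisfy `¬ E` because `b` is in the class of `a₀`, and `Φ` because `b`
      -- and `g b` share a type other than that of `a₀`. Only the remaining conditions need a
      -- formula true of `a₀`.
      have hχ (ψ) (hψ : ψ ∈ Ψ) : ∃ χ : L.Formula X, M.Realize χ a₀ ∧
          ∀ b, M.Realize χ b → E b a₀ → ¬ SameType b a₀ →
            RealizeOver ψ (M.concat b (act g b)) := by
        rcases hΨ hψ with rfl | ⟨χ, hχ, rfl⟩ | hψΦ
        · exact ⟨.imp .falsum .falsum, id, fun b _ hb _ =>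
            (realizeOver_map_inl _ _).2 fun h => hnear b hb ((hε _ _).1 h)⟩
        · exact ⟨χ, hχ, fun b hb _ _ => (realizeOver_map_inl _ _).2 ((realize_map _ _ _).2 hb)⟩
        · refine ⟨.imp .falsum .falsum, id, fun b _ _ hb => ?_⟩
          have : M.concat b (act g b) ∈ relSet (cutRel E (toType M.noParams a₀)) :=
            cutRel_toType_iff.2 ⟨fun h => absurd h hb, (sameType_act hg b).symm⟩
          rw [hΦ] at this
          exact this ψ hψΦ
      have : Nonempty (L.Formula X) := ⟨.falsum⟩
      choose! χ hχa hχ using hχ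
      obtain ⟨θ, hθ⟩ := exists_realize_iff_forall_mem (M := M) (hΨfin.image χ)
      simp only [forall_mem_image] at hθ
      obtain ⟨b, hbθ, hb, hb'⟩ := exists_realize_rel_not_sameType hsat hhom hκ hX hE hε hfin
        ha₀ ((hθ a₀).2 fun ψ hψ => hχa ψ hψ)
      exact ⟨_, fun ψ hψ => hχ ψ hψ b ((hθ b).1 hbθ hψ) hb hb'⟩)
  rw [forall_mem_insert] at hc
  have hc₁ (φ : L.Formula X) (hφ : M.Realize φ a₀) : M.Realize φ fun s i => c s (.inl i) :=
    (realize_map _ _ _).1 <| (realizeOver_map_inl _ _).1 <|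
      hc.2 _ (.inl (mem_image_of_mem (fun φ => emb (φ₁ φ)) hφ))
  have hcE : c ∈ relSet (cutRel E (toType M.noParams a₀)) := by
    rw [hΦ]
    exact fun φ hφ => hc.2 φ (.inr hφ)
  refine (realizeOver_map_inl _ _).1 hc.1 ?_
  rw [← concat_eta c]
  refine (hε _ _).2 ((cutRel_toType_iff.1 hcE).1 (by_contra fun h => ?_))
  obtain ⟨φ, hφ, hφc⟩ := not_sameType_iff.1 h
  exact hφc (hc₁ φ hφ)

theorem act_image_of_forall_mem {Γ : Subgroup (∀ s : L.Sorts, Equiv.Perm (M.carrier s))}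
    {D : Set (M.Tuple X)} (hD : ∀ g ∈ Γ, ∀ a ∈ D, act g a ∈ D)
    {g : ∀ s : L.Sorts, Equiv.Perm (M.carrier s)} (hg : g ∈ Γ) : act g '' D = D := by
  refine Subset.antisymm (image_subset_iff.2 fun a ha => hD g hg a ha) fun a ha =>
    ⟨act g⁻¹ a, hD _ (inv_mem hg) a ha, ?_⟩
  funext s i
  simp [act]

/-- On the type of `a₀` the group given for `E ∩ ≡` works. Any other complete type is a single
class, on which the full automorphism group is transitive by homogeneity. -/
theorem isOrbitalOnTypes_cutRel {κ : Cardinal.{max u w}} (hhom : M.IsStronglyHomogeneous κ)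
    (hκ : ℵ₀ < κ) (hX : Countable (Σ s, X s))
    (h : IsOrbitalOnTypes fun a b => E a b ∧ SameType a b) :
    IsOrbitalOnTypes (cutRel E (toType M.noParams a₀)) := by
  refine ⟨fun a b hab => hab.2, fun p => ?_⟩
  obtain ⟨_, c, rfl⟩ := p
  change IsOrbitalOn _ (toType M.noParams c).realisations
  by_cases hc : SameType c a₀
  · obtain ⟨Γ, hΓ, h1, h2⟩ := h.2 (toType M.noParams c)
    have hiff (a) (ha : a ∈ (toType M.noParams c).realisations) (b) :
        cutRel E (toType M.noParams a₀) a b ↔ E a b ∧ SameType a b := by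
      have : SameType a a₀ := (mem_realisations_toType.1 ha).trans hc
      rw [cutRel_toType_iff, imp_iff_right this]
    refine ⟨Γ, hΓ, fun g hg a ha => ?_, fun a ha b hb hab => h2 a ha b hb ((hiff a ha b).1 hab)⟩
    simp only [hiff a ha]
    exact h1 g hg a ha
  · refine ⟨M.aut, le_rfl, fun g hg a ha => ?_, fun a _ b _ hab => hhom.exists_act_eq hκ hX hab.2⟩
    have ha' : ¬ SameType a a₀ := fun h => hc ((mem_realisations_toType.1 ha).symm.trans h)
    refine act_image_of_forall_mem (Γ := M.aut) (fun g hg b hb => ?_) hg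
    refine ⟨mem_realisations_toType.2 ((sameType_act hg b).trans (mem_realisations_toType.1 hb.1)),
      cutRel_toType_iff.2 ⟨fun h => absurd h ha', ?_⟩⟩
    exact hb.2.2.trans (sameType_act hg b).symm

end SortedLanguage.Str

/-! ### The theorem -/

theorem mainTheorem8 (L : SortedLanguage.{u, v}) (hL : L.IsCountable)
    (M : SortedLanguage.Str.{u, v, w} L) (κ : Cardinal.{max u w}) (hκ : Cardinal.continuum < κ)
    (hsat : M.IsSaturated κ) (hhom : M.IsStronglyHomogeneous κ)
    (X : L.Sorts → Type) (hX : Countable (Σ s, X s))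
    (E : M.Tuple X → M.Tuple X → Prop) (hE : Equivalence E)
    (hdef : IsDefinable M.noParams (relSet E))
    (hbdd : Cardinal.mk (classes E) < κ)
    (p₀ : TypeSpace M X M.noParams) (hp₀ : ¬ p₀.IsIsolated)
    (hsplit : ¬ ∃ C ∈ classes E, p₀.realisations ⊆ C) :
    (classes E).Finite ∧
    Equivalence (cutRel E p₀) ∧
    IsInvariantRel (cutRel E p₀) ∧
    Cardinal.mk (classes (cutRel E p₀)) < κ ∧
    IsFSigma M.noParams (relSet (cutRel E p₀)) ∧
    IsSmooth (cutRel E p₀) ∧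
    ¬ IsTypeDefinable M.noParams (relSet (cutRel E p₀)) ∧
    (IsOrbitalOnTypes (fun a b => E a b ∧ SameType a b) → IsOrbitalOnTypes (cutRel E p₀)) := by
  -- Only the bound on the number of `E'`-classes needs `κ` above the continuum; the other arguments
  -- use `ℵ₀ < κ`.
  have hκ₀ : ℵ₀ < κ := aleph0_lt_continuum.trans hκ
  obtain ⟨ε, hε⟩ := exists_definesRel hdef
  have hfin := hsat.finite_classes hκ₀ hX hE hε hbdd
  obtain ⟨_, a₀, rfl⟩ := p₀
  change ¬ (toType M.noParams a₀).IsIsolated at hp₀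
  obtain ⟨b₀, hb₀, hab⟩ : ∃ b, SameType a₀ b ∧ ¬ E a₀ b := by
    by_contra! h
    exact hsplit ⟨{b | E a₀ b}, ⟨a₀, rfl⟩, fun b hb => h b (mem_realisations_toType.1 hb).symm⟩
  exact ⟨hfin, equivalence_cutRel hE, isInvariantRel_cutRel hε.isInvariantRel,
    mk_classes_cutRel_lt hL hX hκ hE hbdd, isFSigma_cutRel hL hX hε,
    ⟨exists_isElementarySub_countable hL, fun N hN hcount =>
      isSmoothRel_cutRel hL hX hE hε hfin hN hcount⟩,
    not_isTypeDefinable_cutRel hsat hhom hκ₀ hX hE hε hfin hp₀ hb₀ hab,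
    isOrbitalOnTypes_cutRel hhom hκ₀ hX⟩
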